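/- For an exterior $k$-form $\omega$ on $\mathbb R^m$ let $|\omega|$ be its Euclidean norm (the $dx_{i_1}\wedge\dots\wedge dx_{i_k}$, $i_1<\dots<i_k$, being orthonormal) and let the comass $\|\omega\|$ be the maximal value of $\omega$ on $k$-tuples of unit vectors. The Wirtinger constant $W_n$ of $\mathbb R^{2n}$ is the maximum of $|\omega\wedge\omega|/\|\omega\|^2$ over all nonzero $n$-forms $\omega$ on $\mathbb R^{2n}$. Then $W_2=2$ and $W_4=14$ (both maxima are attained). Moreover, on $\mathbb R^8$ write $e^{abcd}=dx_{abcd}+{*}dx_{abcd}$ with $dx_{abcd}=dx_a\wedge dx_b\wedge dx_c\wedge dx_d$, let $$\Phi=e^{1234}+e^{1256}+e^{1278}+e^{1357}-e^{1467}-e^{1368}-e^{1458}$$ be the Cayley form, and let $\mathfrak h$ be the span of the seven forms $e^{1234},e^{1256},e^{1278},e^{1357},e^{1467},e^{1368},e^{1458}$. Let $E_7=\mathfrak{sl}(8,\mathbb R)\oplus\Lambda^4(\mathbb R^8)$ be the real Lie algebra in which $\mathfrak{sl}(8,\mathbb R)$ has its usual bracket and acts on $\Lambda^4$ in the standard way (the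 derivation action with $a\cdot dx_j=\sum_i a_{ij}\,dx_i$), and the bracket $[x,y]\in\mathfrak{sl}(8,\mathbb R)$ of two $4$-forms is determined by $\operatorname{tr}(a[x,y])\,dx_1\wedge\dots\wedge dx_8=(a\cdot x)\wedge y$ for all $a\in\mathfrak{sl}(8,\mathbb R)$. Then: 1. $\Phi$ is self-dual, lies in $\mathfrak h$, and satisfies $\|\Phi\|=1$ and $|\Phi|^2=14$. 2. $\dim\mathfrak h=7$; $\mathfrak h$ is a maximal abelian subspace (for the bracket of $E_7$) of the space $\Lambda^4_+$ of self-dual $4$-forms; and $\mathfrak h$ is a Cartan subalgebra of $E_7$. 3. For every self-dual $4$-form $\omega$ there is $g\in SO(8)$ with $g\cdot\omega\in\mathfrak h$. 4. Every self-dual $4$-form $\omega$ on $\mathbb R^8$ satisfies $|\omega|^2\le 14\,\|\omega\|^2$. -/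

import Mathlib

/- Wirtinger constants, the Cayley form and the Lie algebra `E₇ = sl(8) ⊕ Λ⁴(8)`. -/

noncomputable section

namespace WirtingerE7

/-! ## Exterior forms on Euclidean space -/

/-- Euclidean space `ℝ^m`. -/
abbrev E (m : ℕ) : Type := EuclideanSpace ℝ (Fin m)

/-- Exterior `k`-forms on `ℝ^m`, i.e. elements of `Λ^k ℝ^m`. -/
abbrev Form (k m : ℕ) : Type := E m [⋀^Fin k]→ₗ[ℝ] ℝ

/-- The `i`-th standard basis vector. -/
abbrev stdVec {m : ℕ} (i : Fin m) : E m := EuclideanSpace.single i 1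

/-- The wedge product, a signed sum over shuffles
(so that `(α ∧ β) (u, v) = α u * β v - α v * β u` for `1`-forms). -/
def wedge {k l m : ℕ} (α : Form k m) (β : Form l m) : Form (k + l) m :=
  ((LinearMap.mul' ℝ ℝ).compAlternatingMap (α.domCoprod β)).domDomCongr finSumFinEquiv

/-- The form `dx_{t 0} ∧ ⋯ ∧ dx_{t (k-1)}`, whose value on `(v₀, …, v_{k-1})` is the determinant of
the matrix of coordinates `(v_a)_{t b}`. -/
def dx {k m : ℕ} (t : Fin k → Fin m) : Form k m :=
  Matrix.detRowAlternating.compLinearMap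
    (LinearMap.funLeft ℝ ℝ t ∘ₗ (WithLp.linearEquiv 2 ℝ (Fin m → ℝ)).toLinearMap)

/-- The strictly increasing multi-indices. -/
def incTuples (k m : ℕ) : Finset (Fin k → Fin m) := {I | StrictMono I}

/-- The natural Euclidean norm on `k`-forms, for which the `dx_I` with `I` strictly increasing are
orthonormal. -/
def euclNorm {k m : ℕ} (ω : Form k m) : ℝ :=
  Real.sqrt (∑ I ∈ incTuples k m, ω (fun i => stdVec (I i)) ^ 2)

/-- The comass: the maximal value on a `k`-tuple of unit vectors. -/
def comass {k m : ℕ} (ω : Form k m) : ℝ :=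
  sSup {r | ∃ v : Fin k → E m, (∀ i, ‖v i‖ = 1) ∧ ω v = r}

/-- All the ratios `|ω ∧ ω| / ‖ω‖²` for nonzero `n`-forms `ω` on `ℝ^{2n}`. -/
def wirtingerRatios (n : ℕ) : Set ℝ :=
  {r | ∃ ω : Form n (2 * n), ω ≠ 0 ∧ euclNorm (wedge ω ω) / comass ω ^ 2 = r}

/-- The Wirtinger constant `W_n` of `ℝ^{2n}`. -/
def wirtingerConst (n : ℕ) : ℝ := sSup (wirtingerRatios n)

/-- The coefficient `c` in `η = c • dx_1 ∧ ⋯ ∧ dx_m`, for a form `η` of top degree. -/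
def topCoeff {k m : ℕ} (h : k = m) (η : Form k m) : ℝ := η (fun i => stdVec (Fin.cast h i))

/-- The Hodge star. The coefficient of `dx_J` in `*ω` is the `c` with
`ω ∧ dx_J = c • dx_1 ∧ ⋯ ∧ dx_m`; equivalently `α ∧ *ω = ⟨α, ω⟩ • dx_1 ∧ ⋯ ∧ dx_m` for all `α`. -/
def hodgeStar {k l m : ℕ} (h : k + l = m) (ω : Form k m) : Form l m :=
  ∑ J ∈ incTuples l m, topCoeff h (wedge ω (dx J)) • dx J

/-- The action of a matrix `g` on forms with `g • dx_j = ∑ i, g i j • dx_i`; for orthogonal `g` it is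
the usual action `(g • ω) (v, …) = ω (g⁻¹ v, …)`. -/
def rotate {k m : ℕ} (g : Matrix (Fin m) (Fin m) ℝ) (ω : Form k m) : Form k m :=
  ω.compLinearMap (Matrix.toEuclideanLin g.transpose)

/-! ## Computing with the `dx_I` -/

theorem dx_apply {k m : ℕ} (t : Fin k → Fin m) (v : Fin k → E m) :
    dx t v = (Matrix.of fun a b => v a (t b)).det := rfl

/-- The product of coordinates `v ↦ ∏ b, (v b) (t b)`. -/
def mon {k m : ℕ} (t : Fin k → Fin m) : MultilinearMap ℝ (fun _ : Fin k => E m) ℝ :=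
  (MultilinearMap.mkPiAlgebra ℝ (Fin k) ℝ).compLinearMap
    (fun b => (EuclideanSpace.proj (t b) : E m →L[ℝ] ℝ).toLinearMap)
theorem dx_eq_alt {k m : ℕ} (t : Fin k → Fin m) : dx t = (mon t).alternatization := by
  ext v
  rw [dx_apply, Matrix.det_apply, MultilinearMap.alternatization_apply]
  rfl

theorem wedge_dx {k l m : ℕ} (s : Fin k → Fin m) (t : Fin l → Fin m) :
    wedge (dx s) (dx t) = dx (Fin.append s t) := by
  rw [wedge, dx_eq_alt, dx_eq_alt, ← MultilinearMap.domCoprod_alternization]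
  ext v
  rw [dx_apply, Matrix.det_apply]
  simp [MultilinearMap.alternatization_apply, mon]
  rw [← Equiv.sum_comp (Equiv.permCongr (finSumFinEquiv (m := k) (n := l)))]
  refine Finset.sum_congr rfl fun σ _ => ?_
  simp [Equiv.permCongr_apply, Fin.prod_univ_add]

theorem form_sum_apply {k m : ℕ} {ι : Type*} (s : Finset ι) (f : ι → Form k m) (v : Fin k → E m) :
    (∑ i ∈ s, f i) v = ∑ i ∈ s, f i v := by
  classical
  induction s using Finset.induction_on with
  | empty => simp
  | insert a s ha ih => rw [Finset.sum_insert ha, Finset.sum_insert ha, AlternatingMap.add_apply, ih]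

/-! ## The action of matrices on forms by derivations -/

/-- The derivation of the exterior algebra defined by the matrix `A`, with
`A • dx_j = ∑ i, A i j • dx_i`: the standard action of `sl(m)` on `Λ^k(m)`. -/
def slAct {k m : ℕ} (A : Matrix (Fin m) (Fin m) ℝ) (ω : Form k m) : Form k m :=
  { ∑ i : Fin k, (ω : MultilinearMap ℝ (fun _ : Fin k => E m) ℝ).compLinearMap
      (fun j => if j = i then Matrix.toEuclideanLin A.transpose else LinearMap.id) with
    map_eq_zero_of_eq' := by
      intro v a b hab hne
      have key : ∀ i : Fin k, (fun j => (if j = i then Matrix.toEuclideanLin A.transpose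
          else LinearMap.id : E m →ₗ[ℝ] E m) (v j)) =
          Function.update v i (Matrix.toEuclideanLin A.transpose (v i)) := by
        intro i
        funext j
        by_cases hj : j = i
        · subst hj; simp
        · simp [hj]
      simp only [MultilinearMap.toFun_eq_coe, sum_apply,
        MultilinearMap.compLinearMap_apply, key, AlternatingMap.coe_multilinearMap]
      rw [Finset.sum_eq_add a b hne]
      · rw [hab]
        have : Function.update v b (Matrix.toEuclideanLin A.transpose (v b)) =
            Function.update v a (Matrix.toEuclideanLin A.transpose (v b)) ∘ Equiv.swap a b := by
          funext j
          by_cases hj : j = a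
          · subst hj; simp [Function.update_of_ne hne, Function.update_of_ne hne.symm, hab]
          · by_cases hj' : j = b
            · subst hj'; simp
            · simp [Function.update_of_ne hj, Function.update_of_ne hj',
                Equiv.swap_apply_of_ne_of_ne hj hj']
        rw [this, AlternatingMap.map_swap _ _ hne]
        simp
      · intro c _ hc
        exact AlternatingMap.map_eq_zero_of_eq _ _
          (by rw [Function.update_of_ne hc.1.symm, Function.update_of_ne hc.2.symm, hab]) hne
      · simp
      · simp }

theorem slAct_apply {k m : ℕ} (A : Matrix (Fin m) (Fin m) ℝ) (ω : Form k m) (v : Fin k → E m) :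
    slAct A ω v = ∑ i, ω (Function.update v i (Matrix.toEuclideanLin A.transpose (v i))) := by
  change (∑ i : Fin k, (ω : MultilinearMap ℝ (fun _ : Fin k => E m) ℝ).compLinearMap
      (fun j => if j = i then Matrix.toEuclideanLin A.transpose else LinearMap.id)) v = _
  simp only [sum_apply, MultilinearMap.compLinearMap_apply,
    AlternatingMap.coe_multilinearMap]
  refine Finset.sum_congr rfl fun i _ => congrArg ω ?_
  funext j
  by_cases hj : j = i
  · subst hj; simp
  · simp [hj]

theorem slAct_add_left {k m : ℕ} (A B : Matrix (Fin m) (Fin m) ℝ) (ω : Form k m) :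
    slAct (A + B) ω = slAct A ω + slAct B ω := by
  ext v
  simp [slAct_apply, AlternatingMap.map_update_add, Finset.sum_add_distrib]

theorem slAct_smul_left {k m : ℕ} (c : ℝ) (A : Matrix (Fin m) (Fin m) ℝ) (ω : Form k m) :
    slAct (c • A) ω = c • slAct A ω := by
  ext v
  simp [slAct_apply, AlternatingMap.map_update_smul, Finset.mul_sum]

theorem slAct_add_right {k m : ℕ} (A : Matrix (Fin m) (Fin m) ℝ) (ω η : Form k m) :
    slAct A (ω + η) = slAct A ω + slAct A η := by
  ext v
  simp [slAct_apply, Finset.sum_add_distrib]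

theorem slAct_smul_right {k m : ℕ} (c : ℝ) (A : Matrix (Fin m) (Fin m) ℝ) (ω : Form k m) :
    slAct A (c • ω) = c • slAct A ω := by
  ext v
  simp [slAct_apply, Finset.mul_sum]

/-- The derivation action as a bilinear map. -/
def slActₗ (k m : ℕ) : Matrix (Fin m) (Fin m) ℝ →ₗ[ℝ] Form k m →ₗ[ℝ] Form k m :=
  LinearMap.mk₂ ℝ slAct slAct_add_left slAct_smul_left slAct_add_right slAct_smul_right

theorem slAct_lie {k m : ℕ} (A B : Matrix (Fin m) (Fin m) ℝ) (ω : Form k m) :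
    slAct (A * B - B * A) ω = slAct A (slAct B ω) - slAct B (slAct A ω) := by
  ext v
  simp only [slAct_apply, AlternatingMap.sub_apply]
  have h : ∀ A B : Matrix (Fin m) (Fin m) ℝ,
      ∑ i, ∑ j, ω (Function.update (Function.update v i (Matrix.toEuclideanLin A.transpose (v i))) j
        (Matrix.toEuclideanLin B.transpose
          (Function.update v i (Matrix.toEuclideanLin A.transpose (v i)) j))) =
      ∑ i, ω (Function.update v i (Matrix.toEuclideanLin (A * B).transpose (v i))) +
      ∑ i, ∑ j, if j = i then 0 else
        ω (Function.update (Function.update v i (Matrix.toEuclideanLin A.transpose (v i))) j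
        (Matrix.toEuclideanLin B.transpose (v j))) := by
    intro A B
    rw [← Finset.sum_add_distrib]
    refine Finset.sum_congr rfl fun i _ => ?_
    rw [← Finset.add_sum_erase _ _ (Finset.mem_univ i),
      ← Finset.add_sum_erase (a := i) _ _ (Finset.mem_univ i)]
    simp only [Function.update_self, Function.update_idem, if_true, zero_add]
    congr 1
    · congr 2
      simp [Matrix.transpose_mul, Matrix.toLpLin_apply, Matrix.mulVec_mulVec]
    · refine Finset.sum_congr rfl fun j hj => ?_
      have := Finset.ne_of_mem_erase hj
      simp [this]
  rw [h A B, h B A]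
  have h2 : (∑ i, ∑ j, if j = i then 0 else
        ω (Function.update (Function.update v i (Matrix.toEuclideanLin A.transpose (v i))) j
        (Matrix.toEuclideanLin B.transpose (v j)))) =
      (∑ i, ∑ j, if j = i then 0 else
        ω (Function.update (Function.update v i (Matrix.toEuclideanLin B.transpose (v i))) j
        (Matrix.toEuclideanLin A.transpose (v j)))) := by
    rw [Finset.sum_comm]
    refine Finset.sum_congr rfl fun i _ => Finset.sum_congr rfl fun j _ => ?_
    by_cases hij : i = j
    · simp [hij]
    · rw [if_neg hij, if_neg (Ne.symm hij), Function.update_comm hij]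
  rw [h2, add_sub_add_right_eq_sub, ← Finset.sum_sub_distrib]
  refine Finset.sum_congr rfl fun i _ => ?_
  rw [Matrix.transpose_sub, map_sub, LinearMap.sub_apply, AlternatingMap.map_update_sub]

theorem form_eq_sum {k m : ℕ} (ω : Form k m) :
    ω = ∑ t : Fin k → Fin m, ((k.factorial : ℝ)⁻¹ * ω (fun i => stdVec (t i))) • dx t := by
  refine Module.Basis.ext_alternating (EuclideanSpace.basisFun (Fin m) ℝ).toBasis fun v _ => ?_
  have hd : ∀ t : Fin k → Fin m, dx t (fun i => stdVec (v i)) =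
      ∑ σ : Equiv.Perm (Fin k), if t = v ∘ σ then ((Equiv.Perm.sign σ : ℤ) : ℝ) else 0 := by
    intro t
    rw [dx_apply, Matrix.det_apply]
    refine Finset.sum_congr rfl fun σ _ => ?_
    simp only [Matrix.of_apply, PiLp.single_apply, Finset.prod_ite_zero, Finset.prod_const_one]
    simp only [Finset.mem_univ, true_implies, funext_iff, Function.comp]
    split_ifs <;> simp [Units.smul_def]
  simp only [OrthonormalBasis.coe_toBasis, EuclideanSpace.basisFun_apply, form_sum_apply]
  change ω (fun i => stdVec (v i)) = ∑ t : Fin k → Fin m,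
    ((k.factorial : ℝ)⁻¹ * ω (fun i => stdVec (t i))) • dx t (fun i => stdVec (v i))
  simp only [hd, smul_eq_mul, Finset.mul_sum]
  rw [Finset.sum_comm]
  have : ∀ σ : Equiv.Perm (Fin k), ω (fun i => stdVec ((v ∘ σ) i)) =
      ((Equiv.Perm.sign σ : ℤ) : ℝ) * ω (fun i => stdVec (v i)) := by
    intro σ
    have := ω.map_perm (fun i => stdVec (v i)) σ
    rw [Units.smul_def, zsmul_eq_mul] at this
    exact this
  simp only [mul_ite, mul_zero, Finset.sum_ite_eq', Finset.mem_univ, if_true, this]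
  have hs : ∀ σ : Equiv.Perm (Fin k), ((Equiv.Perm.sign σ : ℤ) : ℝ) * ((Equiv.Perm.sign σ : ℤ) : ℝ) = 1 := by
    intro σ
    rcases Int.units_eq_one_or (Equiv.Perm.sign σ) with h | h <;> simp [h]
  have : ∀ σ : Equiv.Perm (Fin k), (k.factorial : ℝ)⁻¹ * (((Equiv.Perm.sign σ : ℤ) : ℝ) * ω (fun i => stdVec (v i))) * ((Equiv.Perm.sign σ : ℤ) : ℝ) = (k.factorial : ℝ)⁻¹ * ω (fun i => stdVec (v i)) := by
    intro σ
    linear_combination (k.factorial : ℝ)⁻¹ * ω (fun i => stdVec (v i)) * hs σ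
  simp only [this, Finset.sum_const, Finset.card_univ, Fintype.card_perm, Fintype.card_fin, nsmul_eq_mul]
  have : (k.factorial : ℝ) ≠ 0 := by positivity
  field_simp

theorem dx_perm {k m : ℕ} (t : Fin k → Fin m) (σ : Equiv.Perm (Fin k)) :
    dx (t ∘ σ) = ((Equiv.Perm.sign σ : ℤ) : ℝ) • dx t := by
  ext v
  simp only [dx_apply, AlternatingMap.smul_apply, smul_eq_mul]
  rw [← Matrix.det_permute']
  rfl

theorem dx_eq_zero {k m : ℕ} (t : Fin k → Fin m) (h : ¬ Function.Injective t) : dx t = 0 := by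
  ext v
  simp only [Function.Injective, not_forall] at h
  obtain ⟨a, b, hab, hne⟩ := h
  rw [dx_apply, AlternatingMap.zero_apply]
  exact Matrix.det_zero_of_column_eq hne (by intro i; simp [hab])

theorem slAct_dx {k m : ℕ} (A : Matrix (Fin m) (Fin m) ℝ) (t : Fin k → Fin m) :
    slAct A (dx t) = ∑ l, ∑ p, A p (t l) • dx (Function.update t l p) := by
  ext v
  rw [slAct_apply]
  simp only [form_sum_apply, AlternatingMap.smul_apply, dx_apply, Matrix.det_apply]
  rw [Finset.sum_comm]
  simp only [Finset.smul_sum]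
  have : ∀ x : Fin k, ∑ p : Fin m, ∑ σ : Equiv.Perm (Fin k), A p (t x) • Equiv.Perm.sign σ •
      ∏ i, Matrix.of (fun a b => v a (Function.update t x p b)) (σ i) i =
      ∑ σ : Equiv.Perm (Fin k), Equiv.Perm.sign σ • ∑ p : Fin m, A p (t x) •
      ∏ i, Matrix.of (fun a b => v a (Function.update t x p b)) (σ i) i := by
    intro x
    rw [Finset.sum_comm]
    refine Finset.sum_congr rfl fun σ _ => ?_
    rw [Finset.smul_sum]
    exact Finset.sum_congr rfl fun p _ => smul_comm _ _ _
  simp only [this]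
  rw [Finset.sum_comm (s := Finset.univ (α := Fin k))]
  refine Finset.sum_congr rfl fun σ _ => ?_
  rw [← Finset.smul_sum, ← Finset.smul_sum, ← Equiv.sum_comp σ]
  congr 1
  refine Finset.sum_congr rfl fun l _ => ?_
  rw [← Finset.mul_prod_erase _ _ (Finset.mem_univ l)]
  simp only [Matrix.of_apply, Function.update_self, smul_eq_mul]
  have h1 : ∀ p, ∏ i, v (σ i) (Function.update t l p i) =
      v (σ l) p * ∏ i ∈ Finset.univ.erase l, v (σ i) (t i) := by
    intro p
    rw [← Finset.mul_prod_erase _ _ (Finset.mem_univ l), Function.update_self]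
    congr 1
    exact Finset.prod_congr rfl fun i hi => by
      rw [Function.update_of_ne (Finset.ne_of_mem_erase hi)]
  have h2 : ∏ i ∈ Finset.univ.erase l, (Function.update v (σ l)
      (Matrix.toEuclideanLin A.transpose (v (σ l))) (σ i)) (t i) =
      ∏ i ∈ Finset.univ.erase l, v (σ i) (t i) :=
    Finset.prod_congr rfl fun i hi => by
      rw [Function.update_of_ne (fun h => Finset.ne_of_mem_erase hi (σ.injective h))]
  rw [h2]
  simp only [h1, ← mul_assoc, ← Finset.sum_mul]
  congr 1

theorem slAct_top {m : ℕ} (A : Matrix (Fin m) (Fin m) ℝ) {k : ℕ} (h : k = m) (η : Form k m) :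
    topCoeff h (slAct A η) = A.trace * topCoeff h η := by
  subst h
  simp only [topCoeff, Fin.cast_eq_self, slAct_apply, Matrix.trace, Finset.sum_mul]
  refine Finset.sum_congr rfl fun i _ => ?_
  have : Matrix.toEuclideanLin A.transpose (stdVec i) = ∑ j, A i j • stdVec j := by
    ext j
    simp [Matrix.toLpLin_apply, Pi.single_apply]
  rw [this, AlternatingMap.map_update_sum, Finset.sum_eq_single i]
  · rw [AlternatingMap.map_update_smul]
    simp
  · intro j _ hj
    rw [AlternatingMap.map_update_smul]
    rw [AlternatingMap.map_eq_zero_of_eq _ _ (i := i) (j := j) (by simp [Function.update_of_ne hj]) hj.symm]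
    simp
  · simp

theorem wedge_add_left {k l m : ℕ} (α α' : Form k m) (β : Form l m) :
    wedge (α + α') β = wedge α β + wedge α' β := by
  ext v
  simp [wedge, ← AlternatingMap.domCoprod'_apply, TensorProduct.add_tmul]

theorem wedge_add_right {k l m : ℕ} (α : Form k m) (β β' : Form l m) :
    wedge α (β + β') = wedge α β + wedge α β' := by
  ext v
  simp [wedge, ← AlternatingMap.domCoprod'_apply, TensorProduct.tmul_add]

theorem wedge_smul_left {k l m : ℕ} (c : ℝ) (α : Form k m) (β : Form l m) :
    wedge (c • α) β = c • wedge α β := by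
  ext v
  simp only [wedge, ← AlternatingMap.domCoprod'_apply, ← TensorProduct.smul_tmul', map_smul]
  simp

theorem wedge_smul_right {k l m : ℕ} (c : ℝ) (α : Form k m) (β : Form l m) :
    wedge α (c • β) = c • wedge α β := by
  ext v
  simp only [wedge, ← AlternatingMap.domCoprod'_apply, TensorProduct.tmul_smul, map_smul]
  simp

theorem topCoeff_add {k m : ℕ} (h : k = m) (η θ : Form k m) :
    topCoeff h (η + θ) = topCoeff h η + topCoeff h θ := rfl

theorem topCoeff_smul {k m : ℕ} (h : k = m) (c : ℝ) (η : Form k m) :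
    topCoeff h (c • η) = c * topCoeff h η := rfl

/-- The number `c` with `α ∧ β = c • dx_1 ∧ ⋯ ∧ dx_m`, as a bilinear map. -/
def wedgeTop {k l m : ℕ} (h : k + l = m) : Form k m →ₗ[ℝ] Form l m →ₗ[ℝ] ℝ :=
  LinearMap.mk₂ ℝ (fun α β => topCoeff h (wedge α β))
    (fun _ _ _ => by rw [wedge_add_left, topCoeff_add])
    (fun _ _ _ => by rw [wedge_smul_left, topCoeff_smul, smul_eq_mul])
    (fun _ _ _ => by rw [wedge_add_right, topCoeff_add])
    (fun _ _ _ => by rw [wedge_smul_right, topCoeff_smul, smul_eq_mul])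

theorem wedgeTop_apply {k l m : ℕ} (h : k + l = m) (α : Form k m) (β : Form l m) :
    wedgeTop h α β = topCoeff h (wedge α β) := rfl

theorem wedgeTop_dx {k l m : ℕ} (h : k + l = m) (s : Fin k → Fin m) (t : Fin l → Fin m) :
    wedgeTop h (dx s) (dx t) = topCoeff h (dx (Fin.append s t)) := by
  rw [wedgeTop_apply, wedge_dx]

theorem mem_of_dx {k m : ℕ} (K : Submodule ℝ (Form k m)) (h : ∀ t : Fin k → Fin m, dx t ∈ K)
    (ω : Form k m) : ω ∈ K := by
  rw [form_eq_sum ω]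
  exact K.sum_mem fun t _ => K.smul_mem _ (h t)

theorem wedgeTop_symm {k m : ℕ} (h : k + k = m)
    (hk : Equiv.Perm.sign (finAddFlip : Fin (k + k) ≃ Fin (k + k)) = 1) (α β : Form k m) :
    wedgeTop h α β = wedgeTop h β α := by
  have h1 : ∀ s t : Fin k → Fin m, wedgeTop h (dx s) (dx t) = wedgeTop h (dx t) (dx s) := by
    intro s t
    rw [wedgeTop_dx, wedgeTop_dx]
    have : Fin.append t s = Fin.append s t ∘ (finAddFlip : Fin (k + k) ≃ Fin (k + k)) := by
      funext i
      refine Fin.addCases (fun i => ?_) (fun i => ?_) i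
      · rw [Fin.append_left, Function.comp_apply, finAddFlip_apply_castAdd, Fin.append_right]
      · rw [Fin.append_right, Function.comp_apply, finAddFlip_apply_natAdd, Fin.append_left]
    rw [this, dx_perm, hk, topCoeff_smul]
    simp
  have h2 : ∀ (s : Fin k → Fin m) (β : Form k m), wedgeTop h (dx s) β = wedgeTop h β (dx s) :=
    fun s β => sub_eq_zero.mp
      (mem_of_dx (LinearMap.ker (wedgeTop h (dx s) - (wedgeTop h).flip (dx s)))
        (fun t => LinearMap.mem_ker.mpr (sub_eq_zero.mpr (h1 s t))) β)
  exact sub_eq_zero.mp (mem_of_dx (LinearMap.ker ((wedgeTop h).flip β - wedgeTop h β))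
      (fun t => LinearMap.mem_ker.mpr (sub_eq_zero.mpr (h2 t β))) α)

theorem sign_finAddFlip_four :
    Equiv.Perm.sign (finAddFlip : Fin (4 + 4) ≃ Fin (4 + 4)) = 1 := by
  rw [Equiv.Perm.sign_eq_prod_prod_Ioi]
  decide +kernel

theorem append_update_left {k l m : ℕ} (s : Fin k → Fin m) (t : Fin l → Fin m) (x : Fin k)
    (p : Fin m) : Function.update (Fin.append s t) (Fin.castAdd l x) p =
      Fin.append (Function.update s x p) t := by
  funext i
  refine Fin.addCases (fun i => ?_) (fun i => ?_) i
  · simp [Function.update_apply]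
  · simp [Function.update_apply, Fin.ext_iff]
    omega

theorem append_update_right {k l m : ℕ} (s : Fin k → Fin m) (t : Fin l → Fin m) (x : Fin l)
    (p : Fin m) : Function.update (Fin.append s t) (Fin.natAdd k x) p =
      Fin.append s (Function.update t x p) := by
  funext i
  refine Fin.addCases (fun i => ?_) (fun i => ?_) i
  · simp [Function.update_apply, Fin.ext_iff]
    omega
  · simp [Function.update_apply]

theorem wedgeTop_slAct_dx {k l m : ℕ} (A : Matrix (Fin m) (Fin m) ℝ)
    (s : Fin k → Fin m) (t : Fin l → Fin m) (h : k + l = m) :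
    wedgeTop h (slAct A (dx s)) (dx t) + wedgeTop h (dx s) (slAct A (dx t)) =
      A.trace * wedgeTop h (dx s) (dx t) := by
  let T : Form (k + l) m →ₗ[ℝ] ℝ :=
    { toFun := topCoeff h
      map_add' := fun _ _ => rfl
      map_smul' := fun _ _ => rfl }
  have hL : ∀ s t, wedgeTop h (dx s) (dx t) = T (dx (Fin.append s t)) := wedgeTop_dx h
  have hT : A.trace * T (dx (Fin.append s t)) = T (slAct A (dx (Fin.append s t))) :=
    (slAct_top A h (dx (Fin.append s t))).symm
  rw [hL, hT, slAct_dx, slAct_dx, slAct_dx]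
  simp only [map_sum, map_smul, LinearMap.sum_apply, LinearMap.smul_apply, hL, Fin.sum_univ_add,
    Fin.append_left, Fin.append_right, append_update_left, append_update_right, map_add]

theorem wedgeTop_slAct {k l m : ℕ} (h : k + l = m) (A : Matrix (Fin m) (Fin m) ℝ)
    (α : Form k m) (β : Form l m) :
    wedgeTop h (slAct A α) β + wedgeTop h α (slAct A β) = A.trace * wedgeTop h α β := by
  have h2 : ∀ (s : Fin k → Fin m) (β : Form l m), wedgeTop h (slAct A (dx s)) β +
      wedgeTop h (dx s) (slAct A β) - A.trace * wedgeTop h (dx s) β = 0 := fun s β =>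
    mem_of_dx (LinearMap.ker (wedgeTop h (slAct A (dx s)) + wedgeTop h (dx s) ∘ₗ slActₗ l m A
      - A.trace • wedgeTop h (dx s)))
      (fun t => LinearMap.mem_ker.mpr (sub_eq_zero.mpr (wedgeTop_slAct_dx A s t h))) β
  exact sub_eq_zero.mp (mem_of_dx (LinearMap.ker ((wedgeTop h).flip β ∘ₗ slActₗ k m A +
      (wedgeTop h).flip (slAct A β) - A.trace • (wedgeTop h).flip β))
      (fun t => LinearMap.mem_ker.mpr (h2 t β)) α)

theorem slAct_one {k m : ℕ} (ω : Form k m) : slAct 1 ω = (k : ℝ) • ω := by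
  ext v
  simp [slAct_apply]

theorem slAct_sum_single {k m : ℕ} (A : Matrix (Fin m) (Fin m) ℝ) (x : Form k m) :
    slAct A x = ∑ p, ∑ q, A p q • slAct (Matrix.single p q 1) x := by
  have : A = ∑ p, ∑ q, A p q • Matrix.single p q (1 : ℝ) := by
    conv_lhs => rw [Matrix.matrix_eq_sum_single A]
    simp [Matrix.smul_single]
  conv_lhs => rw [this]
  change slActₗ k m _ x = ∑ p, ∑ q, A p q • slActₗ k m (Matrix.single p q 1) x
  simp only [map_sum, map_smul, LinearMap.sum_apply, LinearMap.smul_apply]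

/-! ## The Lie algebra `E₇` -/

/-- The traceless matrix `[x, y]`, for two forms of middle degree, with
`trace (A * [x, y]) dvol = (A • x) ∧ y` for all traceless `A`; see `trace_mul_kappaMat`. -/
def kappaMat {k m : ℕ} (h : k + k = m) (x y : Form k m) : Matrix (Fin m) (Fin m) ℝ :=
  Matrix.of (fun p q => wedgeTop h (slAct (Matrix.single q p 1) x) y) -
    (wedgeTop h x y / 2) • (1 : Matrix (Fin m) (Fin m) ℝ)

theorem trace_mul_kappaMat {k m : ℕ} (h : k + k = m) (A : Matrix (Fin m) (Fin m) ℝ)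
    (x y : Form k m) :
    (A * kappaMat h x y).trace = wedgeTop h (slAct A x) y - A.trace * (wedgeTop h x y / 2) := by
  rw [kappaMat, mul_sub, Matrix.trace_sub, slAct_sum_single A x]
  congr 1
  · simp only [map_sum, map_smul, LinearMap.sum_apply, LinearMap.smul_apply, Matrix.trace,
      Matrix.diag, Matrix.mul_apply, Matrix.of_apply, smul_eq_mul]
  · simp [Matrix.trace_smul, mul_comm]

theorem trace_kappaMat {k m : ℕ} (h : k + k = m) (x y : Form k m) :
    (kappaMat h x y).trace = 0 := by
  have := trace_mul_kappaMat h 1 x y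
  rw [one_mul, slAct_one, Matrix.trace_one, Fintype.card_fin] at this
  have hm : (m : ℝ) = k + k := by rw [← h]; push_cast; ring
  rw [this, hm, map_smul, LinearMap.smul_apply, smul_eq_mul]
  ring

theorem kappaMat_add_left {k m : ℕ} (h : k + k = m) (x x' y : Form k m) :
    kappaMat h (x + x') y = kappaMat h x y + kappaMat h x' y := by
  ext p q
  simp [kappaMat, slAct_add_right]
  ring

theorem kappaMat_smul_left {k m : ℕ} (h : k + k = m) (c : ℝ) (x y : Form k m) :
    kappaMat h (c • x) y = c • kappaMat h x y := by
  ext p q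
  simp [kappaMat, slAct_smul_right]
  ring

theorem kappaMat_swap {k m : ℕ} (h : k + k = m)
    (hs : ∀ α β : Form k m, wedgeTop h α β = wedgeTop h β α) (x y : Form k m) :
    kappaMat h y x = - kappaMat h x y := by
  ext p q
  have h1 := wedgeTop_slAct h (Matrix.single q p 1) x y
  have h2 := hs x (slAct (Matrix.single q p 1) y)
  have h3 := hs x y
  have h4 : (Matrix.single q p (1 : ℝ)).trace = (1 : Matrix (Fin m) (Fin m) ℝ) p q := by
    by_cases hpq : p = q
    · subst hpq; simp
    · simp [hpq, Matrix.trace_single_eq_of_ne _ _ _ (Ne.symm hpq)]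
  simp only [kappaMat, Matrix.sub_apply, Matrix.of_apply, Matrix.smul_apply, Matrix.neg_apply,
    smul_eq_mul]
  rw [h4] at h1
  rw [← h3]
  linarith

theorem eq_of_trace_mul {m : ℕ} {M : Matrix (Fin m) (Fin m) ℝ} (hM : M.trace = 0)
    (h : ∀ A : Matrix (Fin m) (Fin m) ℝ, A.trace = 0 → (A * M).trace = 0) : M = 0 := by
  have := h M.transpose (by rw [Matrix.trace_transpose, hM])
  rwa [← Matrix.conjTranspose_eq_transpose_of_trivial,
    Matrix.trace_conjTranspose_mul_self_eq_zero_iff] at this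

theorem kappaMat_slAct {k m : ℕ} (h : k + k = m) (A : Matrix (Fin m) (Fin m) ℝ)
    (hA : A.trace = 0) (x y : Form k m) :
    A * kappaMat h x y - kappaMat h x y * A = kappaMat h (slAct A x) y + kappaMat h x (slAct A y) := by
  rw [← sub_eq_zero]
  refine eq_of_trace_mul ?_ fun B hB => ?_
  · rw [Matrix.trace_sub, Matrix.trace_sub, Matrix.trace_add, Matrix.trace_mul_comm,
      trace_kappaMat, trace_kappaMat]
    simp
  · have h1 : (B * (A * kappaMat h x y - kappaMat h x y * A)).trace =
        ((B * A - A * B) * kappaMat h x y).trace := by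
      simp only [mul_sub, sub_mul, Matrix.trace_sub, ← mul_assoc]
      congr 1
      rw [Matrix.trace_mul_comm, mul_assoc, ← mul_assoc]
    have h2 : (B * A - A * B).trace = 0 := by
      rw [Matrix.trace_sub, Matrix.trace_mul_comm, sub_self]
    have h3 := wedgeTop_slAct h A (slAct B x) y
    rw [mul_sub, Matrix.trace_sub, h1, mul_add, Matrix.trace_add, trace_mul_kappaMat,
      trace_mul_kappaMat, trace_mul_kappaMat, h2, hB, slAct_lie, map_sub, LinearMap.sub_apply]
    rw [hA] at h3
    linarith


theorem slAct_kappaMat_dx {k m : ℕ} (h : k + k = m) (s t u : Fin k → Fin m) :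
    slAct (kappaMat h (dx s) (dx t)) (dx u) =
      (∑ i, ∑ j, topCoeff h (dx (Fin.append (Function.update s i (u j)) t)) •
        dx (Function.update u j (s i))) -
      (k * topCoeff h (dx (Fin.append s t)) / 2) • dx u := by
  have h1 : ∀ p q, kappaMat h (dx s) (dx t) p q =
      (∑ i, if s i = p then topCoeff h (dx (Fin.append (Function.update s i q) t)) else 0) -
      topCoeff h (dx (Fin.append s t)) / 2 * (1 : Matrix (Fin m) (Fin m) ℝ) p q := by
    intro p q
    simp only [kappaMat, Matrix.sub_apply, Matrix.of_apply, Matrix.smul_apply, smul_eq_mul,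
      wedgeTop_dx]
    congr 1
    rw [slAct_dx, map_sum, LinearMap.sum_apply]
    refine Finset.sum_congr rfl fun i _ => ?_
    rw [map_sum, LinearMap.sum_apply, Finset.sum_eq_single q]
    · rw [map_smul, LinearMap.smul_apply, wedgeTop_dx, Matrix.single_apply]
      by_cases hp : p = s i
      · simp [hp]
      · simp [hp, Ne.symm hp]
    · intro b _ hb
      rw [Matrix.single_apply, if_neg (fun hh => hb hh.1.symm)]
      simp
    · simp
  rw [slAct_dx]
  have hsub : ∀ (a b : ℝ) (ω : Form k m), (a - b) • ω = a • ω - b • ω := by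
    intro a b ω
    ext v
    simp [sub_mul]
  simp only [h1, hsub, Finset.sum_sub_distrib]
  refine congrArg₂ (fun a b : Form k m => a - b) ?_ ?_
  · conv_rhs => rw [Finset.sum_comm]
    refine Finset.sum_congr rfl fun l _ => ?_
    simp only [Finset.sum_smul, ite_smul, zero_smul]
    rw [Finset.sum_comm]
    simp
  · have : ∀ l : Fin k, ∑ p, (topCoeff h (dx (Fin.append s t)) / 2 *
        (1 : Matrix (Fin m) (Fin m) ℝ) p (u l)) • dx (Function.update u l p) =
        (topCoeff h (dx (Fin.append s t)) / 2) • dx u := by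
      intro l
      rw [Finset.sum_eq_single (u l)]
      · simp
      · intro b _ hb
        simp [Matrix.one_apply_ne hb]
      · simp
    simp only [this, Finset.sum_const, Finset.card_univ, Fintype.card_fin]
    rw [← Nat.cast_smul_eq_nsmul ℝ, smul_smul]
    ring_nf

/-- The sign of a permutation, and `0` for a tuple with a repetition. -/
def signTuple {k m : ℕ} (w : Fin k → Fin m) : ℤ :=
  ∏ i, ∏ j ∈ Finset.Ioi i, if w i < w j then 1 else if w j < w i then -1 else 0

theorem topCoeff_dx {k m : ℕ} (h : k = m) (w : Fin k → Fin m) :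
    topCoeff h (dx w) = (signTuple w : ℝ) := by
  subst h
  have hinj : ∀ w : Fin k → Fin k, Function.Injective w → Function.Bijective w := fun w hw =>
    Finite.injective_iff_bijective.mp hw
  by_cases hw : Function.Injective w
  · let σ : Equiv.Perm (Fin k) := Equiv.ofBijective w (hinj w hw)
    have h0 : w = id ∘ σ := rfl
    have h1 : topCoeff rfl (dx (id : Fin k → Fin k)) = 1 := by
      rw [topCoeff, dx_apply, ← Matrix.det_one (n := Fin k)]
      congr 1
      ext a b
      simp [Matrix.one_apply, eq_comm]
    have h2 : (Equiv.Perm.sign σ : ℤ) = signTuple w := by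
      rw [Equiv.Perm.sign_eq_prod_prod_Ioi, signTuple]
      push_cast
      refine Finset.prod_congr rfl fun i _ => Finset.prod_congr rfl fun j hj => ?_
      have : w i ≠ w j := fun h => (Finset.mem_Ioi.mp hj).ne (hw h)
      change (((if w i < w j then 1 else -1 : ℤˣ)) : ℤ) = _
      rcases lt_or_gt_of_ne this with h | h
      · simp [h]
      · simp [h, h.not_gt]
    conv_lhs => rw [h0, dx_perm, topCoeff_smul, h1, h2, mul_one]
  · rw [dx_eq_zero w hw]
    simp only [Function.Injective, not_forall] at hw
    obtain ⟨a, b, hab, hne⟩ := hw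
    have : signTuple w = 0 := by
      rcases lt_or_gt_of_ne hne with h | h
      · exact Finset.prod_eq_zero (Finset.mem_univ a)
          (Finset.prod_eq_zero (Finset.mem_Ioi.mpr h) (by simp [hab]))
      · exact Finset.prod_eq_zero (Finset.mem_univ b)
          (Finset.prod_eq_zero (Finset.mem_Ioi.mpr h) (by simp [hab]))
    rw [this]
    simp [topCoeff]


/-- The cyclic sum in the Jacobi identity for three forms. -/
def jac {k m : ℕ} (h : k + k = m) (x y z : Form k m) : Form k m :=
  slAct (kappaMat h x y) z + slAct (kappaMat h y z) x + slAct (kappaMat h z x) y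

theorem jac_rotate {k m : ℕ} (h : k + k = m) (x y z : Form k m) : jac h y z x = jac h x y z := by
  unfold jac
  abel

theorem slAct_neg_left {k m : ℕ} (A : Matrix (Fin m) (Fin m) ℝ) (ω : Form k m) :
    slAct (-A) ω = - slAct A ω := by
  rw [← neg_one_smul ℝ A, slAct_smul_left]
  ext v
  simp

theorem jac_swap {k m : ℕ} (h : k + k = m) (hs : ∀ α β : Form k m, wedgeTop h α β = wedgeTop h β α)
    (x y z : Form k m) : jac h y x z = - jac h x y z := by
  unfold jac
  rw [kappaMat_swap h hs x y, kappaMat_swap h hs z x, kappaMat_swap h hs y z]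
  simp only [slAct_neg_left]
  abel

theorem jac_add_left {k m : ℕ} (h : k + k = m) (hs : ∀ α β : Form k m, wedgeTop h α β = wedgeTop h β α)
    (x x' y z : Form k m) : jac h (x + x') y z = jac h x y z + jac h x' y z := by
  unfold jac
  rw [kappaMat_swap h hs (x + x') z, kappaMat_swap h hs x z, kappaMat_swap h hs x' z]
  simp only [slAct_neg_left, kappaMat_add_left, slAct_add_left, slAct_add_right]
  abel

theorem jac_smul_left {k m : ℕ} (h : k + k = m) (hs : ∀ α β : Form k m, wedgeTop h α β = wedgeTop h β α)
    (c : ℝ) (x y z : Form k m) : jac h (c • x) y z = c • jac h x y z := by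
  unfold jac
  rw [kappaMat_swap h hs (c • x) z, kappaMat_swap h hs x z]
  simp only [slAct_neg_left, kappaMat_smul_left, slAct_smul_left, slAct_smul_right, smul_add,
    smul_neg]

theorem slAct_jac {k m : ℕ} (h : k + k = m) (A : Matrix (Fin m) (Fin m) ℝ) (hA : A.trace = 0) (x y z : Form k m) :
    slAct A (jac h x y z) =
      jac h (slAct A x) y z + jac h x (slAct A y) z + jac h x y (slAct A z) := by
  have h1 : ∀ x y z : Form k m, slAct A (slAct (kappaMat h x y) z) =
      slAct (kappaMat h (slAct A x) y) z + slAct (kappaMat h x (slAct A y)) z +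
        slAct (kappaMat h x y) (slAct A z) := by
    intro x y z
    rw [← slAct_add_left, ← kappaMat_slAct h A hA, slAct_lie]
    abel
  unfold jac
  simp only [slAct_add_right, h1]
  abel

/-- The `x` with `jac x y z = 0`. -/
def jacKer {k m : ℕ} (h : k + k = m) (hs : ∀ α β : Form k m, wedgeTop h α β = wedgeTop h β α)
    (y z : Form k m) : Submodule ℝ (Form k m) where
  carrier := {x | jac h x y z = 0}
  add_mem' := by
    intro a b ha hb
    exact (jac_add_left h hs a b y z).trans (by rw [show jac h a y z = 0 from ha, show jac h b y z = 0 from hb, add_zero])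
  zero_mem' := by
    have := jac_smul_left h hs 0 0 y z
    rwa [zero_smul, zero_smul] at this
  smul_mem' := by
    intro c a ha
    exact (jac_smul_left h hs c a y z).trans (by rw [show jac h a y z = 0 from ha, smul_zero])

theorem dx_update_mem {k m : ℕ} (K : Submodule ℝ (Form k m)) (t : Fin k → Fin m)
    (ht : Function.Injective t) (i : Fin k) (p : Fin m)
    (hK : t i = p ∨ ∀ ω ∈ K, slAct (Matrix.single p (t i) 1) ω ∈ K) (h : dx t ∈ K) :
    dx (Function.update t i p) ∈ K := by
  rcases hK with hK | hK
  · rwa [← hK, Function.update_eq_self]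
  · have := hK _ h
    rw [slAct_dx, Finset.sum_eq_single i, Finset.sum_eq_single p] at this
    · simpa using this
    · intro b _ hb
      simp [hb.symm]
    · simp
    · intro b _ hb
      refine Finset.sum_eq_zero fun q _ => ?_
      simp [(ht.ne hb).symm]
    · simp

theorem dx_mem_of_strictMono {k m : ℕ} (K : Submodule ℝ (Form k m))
    (h : ∀ t : Fin k → Fin m, StrictMono t → dx t ∈ K) (t : Fin k → Fin m) : dx t ∈ K := by
  by_cases ht : Function.Injective t
  · have h1 : StrictMono (t ∘ Tuple.sort t) :=
      (Tuple.monotone_sort t).strictMono_of_injective (ht.comp (Tuple.sort t).injective)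
    have h2 : t = (t ∘ Tuple.sort t) ∘ (Tuple.sort t).symm := by
      funext i
      simp
    rw [h2, dx_perm]
    exact K.smul_mem _ (h _ h1)
  · rw [dx_eq_zero t ht]
    exact K.zero_mem

theorem update_four {m : ℕ} (a t : Fin 4 → Fin m) :
    Function.update (Function.update (Function.update (Function.update a 3 (t 3)) 2 (t 2)) 1 (t 1))
      0 (t 0) = t ∧
    Function.update (Function.update (Function.update (Function.update a 0 (t 0)) 1 (t 1)) 2 (t 2))
      3 (t 3) = t := by
  constructor <;> funext i <;> fin_cases i <;> simp

theorem dx_mem_up {m : ℕ} (K : Submodule ℝ (Form 4 m)) (r t : Fin 4 → Fin m)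
    (hr : StrictMono r) (ht : StrictMono t) (hrt : ∀ i, r i ≤ t i)
    (hK : ∀ i, r i = t i ∨ ∀ ω ∈ K, slAct (Matrix.single (t i) (r i) 1) ω ∈ K) (h : dx r ∈ K) :
    dx t ∈ K := by
  have r01 : r 0 < r 1 := hr (by decide)
  have r12 : r 1 < r 2 := hr (by decide)
  have r23 : r 2 < r 3 := hr (by decide)
  have t01 : t 0 < t 1 := ht (by decide)
  have t12 : t 1 < t 2 := ht (by decide)
  have t23 : t 2 < t 3 := ht (by decide)
  have e0 := hrt 0
  have e1 := hrt 1
  have e2 := hrt 2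
  have e3 := hrt 3
  rw [← (update_four r t).1]
  refine dx_update_mem K _ ?_ 0 _ (by simpa [Function.update_apply] using hK 0)
    (dx_update_mem K _ ?_ 1 _ (by simpa [Function.update_apply] using hK 1)
    (dx_update_mem K _ ?_ 2 _ (by simpa [Function.update_apply] using hK 2)
    (dx_update_mem K _ ?_ 3 _ (by simpa [Function.update_apply] using hK 3) h)))
  all_goals
    intro a b
    fin_cases a <;> fin_cases b <;> simp <;> omega

theorem dx_mem_down {m : ℕ} (K : Submodule ℝ (Form 4 m)) (r t : Fin 4 → Fin m)
    (hr : StrictMono r) (ht : StrictMono t) (hrt : ∀ i, t i ≤ r i)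
    (hK : ∀ i, r i = t i ∨ ∀ ω ∈ K, slAct (Matrix.single (t i) (r i) 1) ω ∈ K) (h : dx r ∈ K) :
    dx t ∈ K := by
  have r01 : r 0 < r 1 := hr (by decide)
  have r12 : r 1 < r 2 := hr (by decide)
  have r23 : r 2 < r 3 := hr (by decide)
  have t01 : t 0 < t 1 := ht (by decide)
  have t12 : t 1 < t 2 := ht (by decide)
  have t23 : t 2 < t 3 := ht (by decide)
  have e0 := hrt 0
  have e1 := hrt 1
  have e2 := hrt 2
  have e3 := hrt 3
  rw [← (update_four r t).2]
  refine dx_update_mem K _ ?_ 3 _ (by simpa [Function.update_apply] using hK 3)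
    (dx_update_mem K _ ?_ 2 _ (by simpa [Function.update_apply] using hK 2)
    (dx_update_mem K _ ?_ 1 _ (by simpa [Function.update_apply] using hK 1)
    (dx_update_mem K _ ?_ 0 _ (by simpa [Function.update_apply] using hK 0) h)))
  all_goals
    intro a b
    fin_cases a <;> fin_cases b <;> simp <;> omega

/-- The integer `c` with `dx w = c • dx T`, if `w` is a rearrangement of `T`. -/
def coef {k m : ℕ} (T w : Fin k → Fin m) : ℤ :=
  ∑ σ : Equiv.Perm (Fin k), if w = T ∘ σ then (Equiv.Perm.sign σ : ℤ) else 0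

/-- A sufficient condition for `c • dx w` to be a multiple of `dx T`. -/
def TermOK {k m : ℕ} (c : ℤ) (T w : Fin k → Fin m) : Prop :=
  c = 0 ∨ ¬ Function.Injective w ∨ ∃ σ : Equiv.Perm (Fin k), w = T ∘ σ

instance {k m : ℕ} (c : ℤ) (T w : Fin k → Fin m) : Decidable (TermOK c T w) := by
  unfold TermOK; infer_instance

theorem term_eq {k m : ℕ} (c : ℤ) (T w : Fin k → Fin m) (hT : Function.Injective T)
    (h : TermOK c T w) : (c : ℝ) • dx w = ((c * coef T w : ℤ) : ℝ) • dx T := by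
  rcases h with h | h | ⟨σ, rfl⟩
  · simp [h]
  · have : coef T w = 0 := Finset.sum_eq_zero fun σ _ => if_neg (by
      rintro rfl
      exact h (hT.comp σ.injective))
    rw [dx_eq_zero w h, this]
    simp
  · have : coef T (T ∘ σ) = (Equiv.Perm.sign σ : ℤ) := by
      rw [coef, Finset.sum_eq_single σ]
      · simp
      · intro τ _ hτ
        refine if_neg fun hh => hτ ?_
        ext1 i
        exact (hT (congrFun hh i)).symm
      · simp
    rw [dx_perm, this, smul_smul]
    push_cast
    rfl

/-- Twice the coefficient of `dx T` in `[dx s, dx t] • dx u`. -/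
def brInt {k m : ℕ} (s t u T : Fin k → Fin m) : ℤ :=
  2 * (∑ i, ∑ j, signTuple (Fin.append (Function.update s i (u j)) t) *
    coef T (Function.update u j (s i))) - k * (signTuple (Fin.append s t) * coef T u)

/-- A sufficient condition for `[dx s, dx t] • dx u` to be a multiple of `dx T`. -/
def BrOK {k m : ℕ} (s t u T : Fin k → Fin m) : Prop :=
  (∀ i j, TermOK (signTuple (Fin.append (Function.update s i (u j)) t)) T
    (Function.update u j (s i))) ∧ TermOK (signTuple (Fin.append s t)) T u

instance {k m : ℕ} (s t u T : Fin k → Fin m) : Decidable (BrOK s t u T) := by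
  unfold BrOK; infer_instance

theorem br_eq {k m : ℕ} (h : k + k = m) (s t u T : Fin k → Fin m) (hT : Function.Injective T)
    (hOK : BrOK s t u T) :
    (2 : ℝ) • slAct (kappaMat h (dx s) (dx t)) (dx u) = (brInt s t u T : ℝ) • dx T := by
  have h1 := term_eq _ T u hT hOK.2
  have h2 := fun i j => term_eq _ T _ hT (hOK.1 i j)
  rw [slAct_kappaMat_dx]
  simp only [topCoeff_dx, h2]
  have : ((k : ℝ) * (signTuple (Fin.append s t) : ℝ) / 2) • dx u =
      ((k : ℝ) / 2) • ((signTuple (Fin.append s t) * coef T u : ℤ) : ℝ) • dx T := by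
    rw [← h1, smul_smul]
    congr 1
    ring
  rw [this, brInt]
  simp only [← Finset.sum_smul, smul_smul, ← sub_smul]
  congr 1
  push_cast
  ring

theorem jac_dx {k m : ℕ} (h : k + k = m) (s t u T : Fin k → Fin m) (hT : Function.Injective T)
    (h1 : BrOK s t u T) (h2 : BrOK t u s T) (h3 : BrOK u s t T)
    (h4 : brInt s t u T + brInt t u s T + brInt u s t T = 0) : jac h (dx s) (dx t) (dx u) = 0 := by
  have : (2 : ℝ) • jac h (dx s) (dx t) (dx u) = 0 := by
    unfold jac
    rw [smul_add, smul_add, br_eq h _ _ _ T hT h1, br_eq h _ _ _ T hT h2, br_eq h _ _ _ T hT h3,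
      ← add_smul, ← add_smul, ← Int.cast_add, ← Int.cast_add, h4]
    simp
  exact (smul_eq_zero.mp this).resolve_left two_ne_zero

theorem slAct_single_dx_eq_zero {k m : ℕ} (p q : Fin m) (t : Fin k → Fin m)
    (h : ∀ i, t i = q → ¬ Function.Injective (Function.update t i p)) :
    slAct (Matrix.single p q 1) (dx t) = 0 := by
  rw [slAct_dx]
  refine Finset.sum_eq_zero fun i _ => Finset.sum_eq_zero fun p' _ => ?_
  by_cases hh : p = p' ∧ q = t i
  · rw [← hh.1, dx_eq_zero _ (h i hh.2.symm), smul_zero]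
  · rw [Matrix.single_apply, if_neg hh, zero_smul]

theorem trace_single_of_ne {m : ℕ} {p q : Fin m} (hpq : p ≠ q) :
    (Matrix.single p q (1 : ℝ)).trace = 0 := by
  simp [Matrix.trace, hpq]

theorem jac_base (r : Fin 4 → Fin 8) (hr : r = ![0, 1, 2, 3] ∨ r = ![0, 1, 2, 4] ∨
    r = ![0, 1, 4, 5] ∨ r = ![0, 4, 5, 6] ∨ r = ![4, 5, 6, 7]) :
    jac rfl (dx ![4, 5, 6, 7]) (dx ![0, 1, 2, 3]) (dx r) = 0 := by
  have key : Function.Injective r ∧ BrOK ![4, 5, 6, 7] ![0, 1, 2, 3] r r ∧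
      BrOK ![0, 1, 2, 3] r ![4, 5, 6, 7] r ∧ BrOK r ![4, 5, 6, 7] ![0, 1, 2, 3] r ∧
      brInt ![4, 5, 6, 7] ![0, 1, 2, 3] r r + brInt ![0, 1, 2, 3] r ![4, 5, 6, 7] r +
        brInt r ![4, 5, 6, 7] ![0, 1, 2, 3] r = 0 := by
    rcases hr with rfl | rfl | rfl | rfl | rfl <;> decide +kernel
  exact jac_dx rfl _ _ r r key.1 key.2.1 key.2.2.1 key.2.2.2.1 key.2.2.2.2

theorem strictMono_four (t : Fin 4 → Fin 8) (h : t 0 < t 1 ∧ t 1 < t 2 ∧ t 2 < t 3) :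
    StrictMono t := by
  rw [Fin.strictMono_iff_lt_succ]
  intro i
  fin_cases i
  exacts [h.1, h.2.1, h.2.2]

theorem jac_slAct {k m : ℕ} (h : k + k = m) (A : Matrix (Fin m) (Fin m) ℝ) (hA : A.trace = 0)
    (x y z : Form k m) (h0 : jac h x y z = 0) (h1 : jac h x (slAct A y) z = 0)
    (h2 : jac h x y (slAct A z) = 0) : jac h (slAct A x) y z = 0 := by
  have := slAct_jac h A hA x y z
  rw [h0, h1, h2, add_zero, add_zero] at this
  rw [← this]
  exact map_zero (slActₗ k m A)

theorem four_add_four : 4 + 4 = 8 := rfl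

theorem wedgeTop_comm (α β : Form 4 8) :
    wedgeTop four_add_four α β = wedgeTop four_add_four β α :=
  wedgeTop_symm four_add_four sign_finAddFlip_four α β

theorem slAct_high (p q : Fin 8) (hpq : p ≠ q) (hh : q < 4 ∨ 4 ≤ p) :
    slAct (Matrix.single p q 1) (dx ![4, 5, 6, 7]) = 0 := by
  apply slAct_single_dx_eq_zero
  revert p q
  decide +kernel

theorem slAct_low (p q : Fin 8) (hpq : p ≠ q) (hh : 4 ≤ q ∨ p < 4) :
    slAct (Matrix.single p q 1) (dx ![0, 1, 2, 3]) = 0 := by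
  apply slAct_single_dx_eq_zero
  revert p q
  decide +kernel

theorem jac_zero_left (y z : Form 4 8) : jac four_add_four 0 y z = 0 :=
  (jacKer four_add_four wedgeTop_comm y z).zero_mem

theorem jac_zero_mid (y z : Form 4 8) : jac four_add_four y 0 z = 0 := by
  rw [← jac_rotate, jac_zero_left]

theorem jac_zero_right (y z : Form 4 8) : jac four_add_four y z 0 = 0 := by
  rw [← jac_rotate, jac_zero_mid]

theorem jac_step_three (z : Form 4 8) :
    jac four_add_four z (dx ![4, 5, 6, 7]) (dx ![0, 1, 2, 3]) = 0 := by
  let K := jacKer four_add_four wedgeTop_comm (dx ![4, 5, 6, 7]) (dx ![0, 1, 2, 3])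
  change z ∈ K
  refine mem_of_dx K (dx_mem_of_strictMono K fun t ht => ?_) z
  have hK : ∀ p q : Fin 8, (p < 4 ∧ q < 4) ∨ (4 ≤ p ∧ 4 ≤ q) → q = p ∨
      ∀ ω ∈ K, slAct (Matrix.single p q 1) ω ∈ K := by
    intro p q hpq
    by_cases hne : q = p
    · exact Or.inl hne
    · refine Or.inr fun ω hω => ?_
      refine jac_slAct four_add_four _ (trace_single_of_ne (Ne.symm hne)) _ _ _ hω ?_ ?_
      · rw [slAct_high p q (Ne.symm hne) (by omega), jac_zero_mid]
      · rw [slAct_low p q (Ne.symm hne) (by omega), jac_zero_right]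
  have t01 : t 0 < t 1 := ht (by decide)
  have t12 : t 1 < t 2 := ht (by decide)
  have t23 : t 2 < t 3 := ht (by decide)
  have go : ∀ r : Fin 4 → Fin 8, (r = ![0, 1, 2, 3] ∨ r = ![0, 1, 2, 4] ∨
      r = ![0, 1, 4, 5] ∨ r = ![0, 4, 5, 6] ∨ r = ![4, 5, 6, 7]) →
      (∀ i, r i ≤ t i ∧ ((t i < 4 ∧ r i < 4) ∨ (4 ≤ t i ∧ 4 ≤ r i))) → dx t ∈ K := by
    intro r hr hrt
    refine dx_mem_up K r t ?_ ht (fun i => (hrt i).1) (fun i => hK _ _ (hrt i).2) ?_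
    · rw [Fin.strictMono_iff_lt_succ]
      rcases hr with rfl | rfl | rfl | rfl | rfl <;> decide
    · change jac _ _ _ _ = 0
      rw [← jac_rotate]
      exact jac_base r hr
  have hcase : (t 3 < 4) ∨ (t 2 < 4 ∧ 4 ≤ t 3) ∨ (t 1 < 4 ∧ 4 ≤ t 2) ∨ (t 0 < 4 ∧ 4 ≤ t 1) ∨
      4 ≤ t 0 := by omega
  rcases hcase with hc | hc | hc | hc | hc
  · refine go ![0, 1, 2, 3] (by simp) fun i => ?_
    fin_cases i <;> simp <;> omega
  · refine go ![0, 1, 2, 4] (by simp) fun i => ?_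
    fin_cases i <;> simp <;> omega
  · refine go ![0, 1, 4, 5] (by simp) fun i => ?_
    fin_cases i <;> simp <;> omega
  · refine go ![0, 4, 5, 6] (by simp) fun i => ?_
    fin_cases i <;> simp <;> omega
  · refine go ![4, 5, 6, 7] (by simp) fun i => ?_
    fin_cases i <;> simp <;> omega

theorem jac_step_two (y z : Form 4 8) : jac four_add_four y z (dx ![4, 5, 6, 7]) = 0 := by
  let K : Submodule ℝ (Form 4 8) :=
    ⨅ z, jacKer four_add_four wedgeTop_comm z (dx ![4, 5, 6, 7])
  have hmem : ∀ y, y ∈ K ↔ ∀ z, jac four_add_four y z (dx ![4, 5, 6, 7]) = 0 := fun y =>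
    Submodule.mem_iInf _
  refine (hmem y).mp (mem_of_dx K (dx_mem_of_strictMono K fun t ht => ?_) y) z
  have t01 : t 0 < t 1 := ht (by decide)
  have t12 : t 1 < t 2 := ht (by decide)
  have t23 : t 2 < t 3 := ht (by decide)
  refine dx_mem_up K ![0, 1, 2, 3] t (strictMono_four _ (by decide)) ht ?_ ?_ ?_
  · intro i
    fin_cases i <;> simp <;> omega
  · intro i
    by_cases hne : (![0, 1, 2, 3] : Fin 4 → Fin 8) i = t i
    · exact Or.inl hne
    · refine Or.inr fun ω hω => (hmem _).mpr fun z => ?_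
      rw [hmem] at hω
      refine jac_slAct four_add_four _ (trace_single_of_ne (Ne.symm hne)) _ _ _ (hω z) (hω _) ?_
      rw [slAct_high _ _ (Ne.symm hne) (Or.inl (by fin_cases i <;> simp)), jac_zero_right]
  · rw [hmem]
    intro z
    rw [← jac_rotate]
    exact jac_step_three z

theorem jac_eq_zero (x y z : Form 4 8) : jac four_add_four x y z = 0 := by
  let K : Submodule ℝ (Form 4 8) := ⨅ y, ⨅ z, jacKer four_add_four wedgeTop_comm y z
  have hmem : ∀ x, x ∈ K ↔ ∀ y z, jac four_add_four x y z = 0 := fun x => by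
    simp only [K, Submodule.mem_iInf]
    rfl
  refine (hmem x).mp (mem_of_dx K (dx_mem_of_strictMono K fun t ht => ?_) x) y z
  have t01 : t 0 < t 1 := ht (by decide)
  have t12 : t 1 < t 2 := ht (by decide)
  have t23 : t 2 < t 3 := ht (by decide)
  refine dx_mem_down K ![4, 5, 6, 7] t (strictMono_four _ (by decide)) ht ?_ ?_ ?_
  · intro i
    fin_cases i <;> simp <;> omega
  · intro i
    by_cases hne : (![4, 5, 6, 7] : Fin 4 → Fin 8) i = t i
    · exact Or.inl hne
    · refine Or.inr fun ω hω => (hmem _).mpr fun y z => ?_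
      rw [hmem] at hω
      exact jac_slAct four_add_four _ (trace_single_of_ne (Ne.symm hne)) _ _ _ (hω y z) (hω _ _)
        (hω _ _)
  · rw [hmem]
    intro y z
    rw [← jac_rotate]
    exact jac_step_two y z

section LieAlgebraE7

attribute [local instance 100] LieRing.ofAssociativeRing

/-- The Lie algebra `sl(8)` of traceless real matrices. -/
abbrev sl8 : LieSubalgebra ℝ (Matrix (Fin 8) (Fin 8) ℝ) := LieAlgebra.SpecialLinear.sl (Fin 8) ℝ

/-- The component `Λ⁴(8) × Λ⁴(8) → sl(8)` of the Lie bracket of `E₇`. -/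
def kappa (x y : Form 4 8) : sl8 :=
  ⟨kappaMat four_add_four x y, LinearMap.mem_ker.mpr (trace_kappaMat four_add_four x y)⟩

/-- The defining property of the bracket of two `4`-forms: `(a, [x, y])_sl = ([a, x], y)_Λ`, with
`(a, b)_sl = trace (a b)` and `(α, β)_Λ dvol = α ∧ β`. -/
theorem trace_mul_kappa (a : sl8) (x y : Form 4 8) :
    (a.1 * (kappa x y).1).trace = wedgeTop four_add_four (slAct a.1 x) y := by
  have ha : a.1.trace = 0 := LinearMap.mem_ker.mp a.2
  refine (trace_mul_kappaMat four_add_four a.1 x y).trans ?_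
  rw [ha, zero_mul, sub_zero]

/-- The (split real form of the) exceptional Lie algebra `E₇ = sl(8) ⊕ Λ⁴(8)`. -/
abbrev E7 : Type := sl8 × Form 4 8

namespace E7

/-- The bracket of `sl(8)`, the standard action of `sl(8)` on `Λ⁴(8)`, and the bracket of two
`4`-forms characterized by `trace_mul_kappa`. -/
instance : Bracket E7 E7 where
  bracket X Y := (⁅X.1, Y.1⁆ + kappa X.2 Y.2, slAct X.1.1 Y.2 - slAct Y.1.1 X.2)

theorem lie_fst (X Y : E7) : (⁅X, Y⁆ : E7).1.1 =
    X.1.1 * Y.1.1 - Y.1.1 * X.1.1 + kappaMat four_add_four X.2 Y.2 := rfl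

theorem lie_snd (X Y : E7) : (⁅X, Y⁆ : E7).2 = slAct X.1.1 Y.2 - slAct Y.1.1 X.2 := rfl

theorem add_fst (X Y : E7) : (X + Y).1.1 = X.1.1 + Y.1.1 := rfl

theorem add_snd (X Y : E7) : (X + Y).2 = X.2 + Y.2 := rfl

theorem smul_fst (c : ℝ) (X : E7) : (c • X).1.1 = c • X.1.1 := rfl

theorem smul_snd (c : ℝ) (X : E7) : (c • X).2 = c • X.2 := rfl

theorem ext_iff_val {X Y : E7} (h1 : X.1.1 = Y.1.1) (h2 : X.2 = Y.2) : X = Y :=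
  Prod.ext (Subtype.ext h1) h2

theorem kappaMat_add_right (x y z : Form 4 8) : kappaMat four_add_four x (y + z) =
    kappaMat four_add_four x y + kappaMat four_add_four x z := by
  rw [kappaMat_swap _ wedgeTop_comm (y + z) x, kappaMat_swap _ wedgeTop_comm y x,
    kappaMat_swap _ wedgeTop_comm z x, kappaMat_add_left, neg_add]

theorem kappaMat_neg_left (x y : Form 4 8) : kappaMat four_add_four (-x) y =
    - kappaMat four_add_four x y := by
  rw [← neg_one_smul ℝ x, kappaMat_smul_left, neg_one_smul]

theorem kappaMat_neg_right (x y : Form 4 8) : kappaMat four_add_four x (-y) =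
    - kappaMat four_add_four x y := by
  rw [kappaMat_swap _ wedgeTop_comm (-y) x, kappaMat_swap _ wedgeTop_comm y x, kappaMat_neg_left]

theorem slAct_sub_right (A : Matrix (Fin 8) (Fin 8) ℝ) (x y : Form 4 8) :
    slAct A (x - y) = slAct A x - slAct A y :=
  map_sub (slActₗ 4 8 A) x y

theorem kappaMat_smul_right (c : ℝ) (x y : Form 4 8) : kappaMat four_add_four x (c • y) =
    c • kappaMat four_add_four x y := by
  rw [kappaMat_swap _ wedgeTop_comm (c • y) x, kappaMat_swap _ wedgeTop_comm y x,
    kappaMat_smul_left, smul_neg]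

theorem kappaMat_self (x : Form 4 8) : kappaMat four_add_four x x = 0 := by
  ext p q
  have := congrFun (congrFun (kappaMat_swap four_add_four wedgeTop_comm x x) p) q
  rw [Matrix.neg_apply] at this
  rw [Matrix.zero_apply]
  linarith

theorem slAct_neg_right (A : Matrix (Fin 8) (Fin 8) ℝ) (x : Form 4 8) :
    slAct A (-x) = - slAct A x :=
  map_neg (slActₗ 4 8 A) x

instance : LieRing E7 where
  add_lie X Y Z := ext_iff_val
    (by
      simp only [lie_fst, add_fst, add_snd, kappaMat_add_left]
      noncomm_ring)
    (by
      simp only [lie_snd, add_fst, add_snd, slAct_add_left, slAct_add_right]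
      abel)
  lie_add X Y Z := ext_iff_val
    (by
      simp only [lie_fst, add_fst, add_snd, kappaMat_add_right]
      noncomm_ring)
    (by
      simp only [lie_snd, add_fst, add_snd, slAct_add_left, slAct_add_right]
      abel)
  lie_self X := ext_iff_val
    (by
      rw [lie_fst, kappaMat_self, sub_self, add_zero]
      rfl)
    (by
      rw [lie_snd, sub_self]
      rfl)
  leibniz_lie X Y Z := ext_iff_val
    (by
      have hX : X.1.1.trace = 0 := LinearMap.mem_ker.mp X.1.2
      have hY : Y.1.1.trace = 0 := LinearMap.mem_ker.mp Y.1.2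
      have hZ : Z.1.1.trace = 0 := LinearMap.mem_ker.mp Z.1.2
      have e1 := kappaMat_slAct four_add_four X.1.1 hX Y.2 Z.2
      have e2 := kappaMat_slAct four_add_four Y.1.1 hY X.2 Z.2
      have e3 := kappaMat_slAct four_add_four Z.1.1 hZ X.2 Y.2
      have s1 := kappaMat_swap four_add_four wedgeTop_comm Y.2 (slAct Z.1.1 X.2)
      simp only [lie_fst, lie_snd, add_fst, sub_eq_add_neg, kappaMat_add_right, kappaMat_add_left,
        kappaMat_neg_left, kappaMat_neg_right]
      rw [s1] at e3
      rw [eq_sub_of_add_eq' e2.symm, eq_sub_of_add_eq' e3.symm, eq_sub_of_add_eq e1.symm]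
      noncomm_ring)
    (by
      have j := jac_eq_zero X.2 Y.2 Z.2
      unfold jac at j
      rw [kappaMat_swap four_add_four wedgeTop_comm X.2 Z.2, slAct_neg_left,
        ← sub_eq_add_neg, sub_eq_zero] at j
      simp only [lie_snd, lie_fst, add_snd, slAct_add_left, slAct_lie, slAct_sub_right, ← j]
      abel)

instance : LieAlgebra ℝ E7 where
  lie_smul c X Y := ext_iff_val
    (by
      simp only [lie_fst, smul_fst, smul_snd, kappaMat_smul_right, mul_smul_comm, smul_mul_assoc,
        smul_add, smul_sub])
    (by
      simp only [lie_snd, smul_fst, smul_snd, slAct_smul_left, slAct_smul_right]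
      ext v
      simp [mul_sub])

/-- The inclusion of `Λ⁴(8)` in `E₇`. -/
def ofForm : Form 4 8 →ₗ[ℝ] E7 := LinearMap.inr ℝ sl8 (Form 4 8)

end E7

end LieAlgebraE7

/-! ## The Cayley form -/

theorem hodgeStar_eq {k l m : ℕ} (h : k + l = m) (ω : Form k m) :
    hodgeStar h ω = ∑ J ∈ incTuples l m, wedgeTop h ω (dx J) • dx J := rfl

/-- The Hodge star as a linear map. -/
def hodgeStarₗ {k l m : ℕ} (h : k + l = m) : Form k m →ₗ[ℝ] Form l m where
  toFun := hodgeStar h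
  map_add' α β := by
    simp only [hodgeStar_eq, map_add, LinearMap.add_apply, add_smul, Finset.sum_add_distrib]
  map_smul' c α := by
    simp only [hodgeStar_eq, map_smul, LinearMap.smul_apply, smul_assoc, Finset.smul_sum,
      RingHom.id_apply]

/-- The space `Λ⁴₊(8)` of self-dual `4`-forms on `ℝ^8`, those with `*ω = ω`. -/
def selfDual : Submodule ℝ (Form 4 8) :=
  LinearMap.eqLocus (hodgeStarₗ four_add_four) LinearMap.id

theorem mem_selfDual (ω : Form 4 8) : ω ∈ selfDual ↔ hodgeStar four_add_four ω = ω := Iff.rfl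

/-- The form `e^{abcd} = dx_{abcd} + *dx_{abcd}`, with indices counted from `0`. -/
def sdForm (a b c d : Fin 8) : Form 4 8 :=
  dx ![a, b, c, d] + hodgeStar four_add_four (dx ![a, b, c, d])

/-- The Cayley form
`e^{1234} + e^{1256} + e^{1278} + e^{1357} - e^{1467} - e^{1368} - e^{1458}`. -/
def cayley : Form 4 8 :=
  sdForm 0 1 2 3 + sdForm 0 1 4 5 + sdForm 0 1 6 7 + sdForm 0 2 4 6
    - sdForm 0 3 5 6 - sdForm 0 2 5 7 - sdForm 0 3 4 7

/-- The span of the seven self-dual forms whose signed sum is the Cayley form. -/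
def cayleySpan : Submodule ℝ (Form 4 8) :=
  Submodule.span ℝ {sdForm 0 1 2 3, sdForm 0 1 4 5, sdForm 0 1 6 7, sdForm 0 2 4 6,
    sdForm 0 3 5 6, sdForm 0 2 5 7, sdForm 0 3 4 7}

/-- A space of `4`-forms is abelian if its elements commute in `E₇`. -/
def IsAbelianInE7 (a : Submodule ℝ (Form 4 8)) : Prop :=
  ∀ x ∈ a, ∀ y ∈ a, ⁅E7.ofForm x, E7.ofForm y⁆ = 0

end WirtingerE7

end

open WirtingerE7

/-! Everything rests on the combinatorics of fourteen 4-subsets of the eight axes: the seven `cw i`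
and their complements. They are the weight-4 words of the extended Hamming code, that is, the blocks
of a Steiner system S(3,4,8). Three axes lie in exactly one block, and two blocks share 0, 2 or 4
axes. Moving one axis of a block therefore never gives another block, while every 4-subset that is
not a block is one move away from one. The Hodge star exchanges a block with its complement, with
sign +1.

Lie algebra. For `y` in the span `𝔥` and a traceless matrix `A`, the coefficient of `A·y` at a block
`I` sees only the diagonal of `A`, namely the partial trace of `A` over `I`. The partial traces over
`I` and its complement add up to `tr A = 0`, so `𝔥` is abelian (`kappaMat_of_mem`). Conversely,
testing a form that commutes with `𝔥` against elementary and diagonal matrices shows that it lies in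
`𝔥` (`mem_cayleySpan_of_kappaMat`), and a matrix that preserves `𝔥` is zero
(`eq_zero_of_slAct_mem`). Together these give maximality and the Cartan property.

Conjugation. For a regular `u` in `𝔥`, the function `g ↦ ⟨u, g·ω⟩` attains a maximum on the compact
group `SO(8)`. At a maximum its derivative vanishes along all 28 plane rotations. These are 28
linear equations for the 28 self-dual coordinates off `𝔥`, and they force those coordinates to
vanish (`coeff_zero_of_critical`, `exists_rotate_mem`).

Bound for `W₄`. For an arbitrary `ω`, the form `σ = ω + *ω` is self-dual, and `|ω - *ω|² ≥ 0` gives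
`4 ω∧ω ≤ |σ|²`. After a rotation `σ` lies in `𝔥`. Each of its seven coordinates is then a sum of two
coefficients of the rotated `ω`, hence at most `2‖ω‖` in absolute value. So `4 ω∧ω ≤ 2·7·4‖ω‖²`
(`wedgeTop_self_le`). A reflection handles the other sign. The Cayley form attains the bound: fixing
its middle arguments `v, w` leaves a matrix `M` with `|Mz|²` equal to the Gram determinant of `v, w,
z`, so its comass is 1 (`cayleyMat_gram`, `cayley_apply_le`).

Bound for `W₂`. Here `ω∧ω` is twice the Pfaffian of the coefficient matrix, whose square is the
determinant. Hadamard's inequality applies because every row has norm at most the comass. The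
standard symplectic form gives equality. -/

noncomputable section

namespace WirtingerE7

/-! ## Coefficients of forms -/

/-- The value of a form on a tuple of standard basis vectors. -/
def coeff {k m : ℕ} (t : Fin k → Fin m) : Form k m →ₗ[ℝ] ℝ where
  toFun ω := ω fun i => stdVec (t i)
  map_add' _ _ := rfl
  map_smul' _ _ := rfl

theorem coeff_apply {k m : ℕ} (t : Fin k → Fin m) (ω : Form k m) :
    coeff t ω = ω fun i => stdVec (t i) := rfl

theorem coeff_dx {k m : ℕ} (t s : Fin k → Fin m) :
    coeff t (dx s) = (Matrix.of fun a b => if t a = s b then (1 : ℝ) else 0).det := by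
  rw [coeff_apply, dx_apply]
  congr 1
  ext a b
  simp [eq_comm]

theorem coeff_dx_comm {k m : ℕ} (t s : Fin k → Fin m) : coeff t (dx s) = coeff s (dx t) := by
  rw [coeff_dx, coeff_dx, ← Matrix.det_transpose]
  congr 1
  ext a b
  simp [eq_comm]

theorem coeff_dx_self {k m : ℕ} (t : Fin k → Fin m) (ht : Function.Injective t) :
    coeff t (dx t) = 1 := by
  rw [coeff_dx, ← Matrix.det_one (n := Fin k)]
  congr 1
  ext a b
  simp [Matrix.one_apply, ht.eq_iff]

theorem coeff_dx_eq_zero_left {k m : ℕ} {t s : Fin k → Fin m} (a : Fin k)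
    (h : ∀ b, t a ≠ s b) : coeff t (dx s) = 0 := by
  rw [coeff_dx]
  exact Matrix.det_eq_zero_of_row_eq_zero a fun b => by simp [h b]

theorem coeff_dx_eq_zero_right {k m : ℕ} {t s : Fin k → Fin m} (b : Fin k)
    (h : ∀ a, s b ≠ t a) : coeff t (dx s) = 0 := by
  rw [coeff_dx_comm]
  exact coeff_dx_eq_zero_left b h

theorem coeff_perm {k m : ℕ} (t : Fin k → Fin m) (σ : Equiv.Perm (Fin k)) (ω : Form k m) :
    coeff (t ∘ σ) ω = ((Equiv.Perm.sign σ : ℤ) : ℝ) * coeff t ω := by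
  have := ω.map_perm (fun i => stdVec (t i)) σ
  rw [Units.smul_def, zsmul_eq_mul] at this
  exact this

theorem coeff_eq_zero {k m : ℕ} {t : Fin k → Fin m} (h : ¬ Function.Injective t) (ω : Form k m) :
    coeff t ω = 0 := by
  simp only [Function.Injective, not_forall] at h
  obtain ⟨a, b, hab, hne⟩ := h
  exact ω.map_eq_zero_of_eq _ (by rw [hab]) hne

theorem mem_incTuples {k m : ℕ} {t : Fin k → Fin m} : t ∈ incTuples k m ↔ StrictMono t := by
  simp [incTuples]

theorem exists_perm_of_forall_mem {k m : ℕ} {t s : Fin k → Fin m} (ht : Function.Injective t)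
    (h : ∀ a, ∃ b, t a = s b) : ∃ σ : Equiv.Perm (Fin k), t = s ∘ σ := by
  choose f hf using h
  have hinj : Function.Injective f := fun a b hab => ht (by rw [hf, hf, hab])
  exact ⟨Equiv.ofBijective f (Finite.injective_iff_bijective.mp hinj), funext hf⟩

/-- The permutation that relates the two tuples is increasing, and `Fin k` has only one order
automorphism. -/
theorem strictMono_unique {k m : ℕ} {t s : Fin k → Fin m} (ht : StrictMono t) (hs : StrictMono s)
    (h : ∀ a, ∃ b, t a = s b) : t = s := by
  obtain ⟨σ, hσ⟩ := exists_perm_of_forall_mem ht.injective h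
  have : StrictMono σ := fun a b hab => by
    have := ht hab
    rw [hσ] at this
    exact hs.lt_iff_lt.mp this
  have hid : σ = 1 := by
    have h1 : (this.orderIsoOfSurjective _ σ.surjective) = OrderIso.refl _ := Subsingleton.elim _ _
    ext1 a
    exact congrArg (fun e : Fin k ≃o Fin k => e a) h1
  rw [hσ, hid]
  rfl

theorem coeff_dx_strictMono {k m : ℕ} {t s : Fin k → Fin m} (ht : StrictMono t)
    (hs : StrictMono s) : coeff t (dx s) = if t = s then 1 else 0 := by
  split_ifs with h
  · rw [h, coeff_dx_self s hs.injective]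
  · have : ¬ ∀ a, ∃ b, t a = s b := fun hh => h (strictMono_unique ht hs hh)
    push Not at this
    obtain ⟨a, ha⟩ := this
    exact coeff_dx_eq_zero_left a ha

theorem mem_of_dx_strictMono {k m : ℕ} (K : Submodule ℝ (Form k m))
    (h : ∀ t : Fin k → Fin m, StrictMono t → dx t ∈ K) (ω : Form k m) : ω ∈ K :=
  mem_of_dx K (dx_mem_of_strictMono K h) ω

theorem linearMap_ext_dx {k m : ℕ} {M : Type*} [AddCommGroup M] [Module ℝ M]
    {f g : Form k m →ₗ[ℝ] M} (h : ∀ t : Fin k → Fin m, StrictMono t → f (dx t) = g (dx t)) :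
    f = g :=
  LinearMap.ext fun ω => mem_of_dx_strictMono (LinearMap.eqLocus f g) h ω

theorem form_eq_sum_incTuples {k m : ℕ} (ω : Form k m) :
    ω = ∑ J ∈ incTuples k m, coeff J ω • dx J := by
  have : (LinearMap.id : Form k m →ₗ[ℝ] Form k m) =
      ∑ J ∈ incTuples k m, (coeff J).smulRight (dx J) := by
    refine linearMap_ext_dx fun t ht => ?_
    rw [LinearMap.sum_apply, Finset.sum_eq_single t]
    · simp [coeff_dx_self t ht.injective]
    · intro s hs hst
      rw [LinearMap.smulRight_apply, coeff_dx_strictMono (mem_incTuples.mp hs) ht, if_neg hst,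
        zero_smul]
    · exact fun h => absurd (mem_incTuples.mpr ht) h
  conv_lhs => rw [← LinearMap.id_apply (R := ℝ) ω, this]
  simp [LinearMap.sum_apply]

theorem form_ext_coeff {k m : ℕ} {α β : Form k m}
    (h : ∀ t : Fin k → Fin m, StrictMono t → coeff t α = coeff t β) : α = β := by
  rw [form_eq_sum_incTuples α, form_eq_sum_incTuples β]
  exact Finset.sum_congr rfl fun t ht => by rw [h t (mem_incTuples.mp ht)]

/-! ## The inner product of forms -/

/-- The inner product for which the `dx_I` with `I` strictly increasing are orthonormal. -/
def formInner (k m : ℕ) : Form k m →ₗ[ℝ] Form k m →ₗ[ℝ] ℝ :=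
  ∑ J ∈ incTuples k m, (LinearMap.mul ℝ ℝ).compl₁₂ (coeff J) (coeff J)

theorem formInner_apply {k m : ℕ} (α β : Form k m) :
    formInner k m α β = ∑ J ∈ incTuples k m, coeff J α * coeff J β := by
  simp [formInner, LinearMap.sum_apply]

theorem formInner_comm {k m : ℕ} (α β : Form k m) :
    formInner k m α β = formInner k m β α := by
  simp only [formInner_apply, mul_comm]

theorem formInner_dx_left {k m : ℕ} (t : Fin k → Fin m) (β : Form k m) :
    formInner k m (dx t) β = coeff t β := by
  have : formInner k m (dx t) = coeff t := by
    refine linearMap_ext_dx fun s hs => ?_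
    rw [formInner_apply, Finset.sum_eq_single s]
    · rw [coeff_dx_self s hs.injective, mul_one, coeff_dx_comm]
    · intro J hJ hJs
      rw [coeff_dx_strictMono (mem_incTuples.mp hJ) hs, if_neg hJs, mul_zero]
    · exact fun h => absurd (mem_incTuples.mpr hs) h
  rw [this]

theorem formInner_dx_right {k m : ℕ} (t : Fin k → Fin m) (α : Form k m) :
    formInner k m α (dx t) = coeff t α := by
  rw [formInner_comm, formInner_dx_left]

theorem euclNorm_eq {k m : ℕ} (ω : Form k m) : euclNorm ω = Real.sqrt (formInner k m ω ω) := by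
  rw [formInner_apply, euclNorm]
  congr 1
  exact Finset.sum_congr rfl fun J _ => sq _

theorem formInner_self_nonneg {k m : ℕ} (ω : Form k m) : 0 ≤ formInner k m ω ω := by
  rw [formInner_apply]
  exact Finset.sum_nonneg fun J _ => mul_self_nonneg _

theorem euclNorm_sq {k m : ℕ} (ω : Form k m) : euclNorm ω ^ 2 = formInner k m ω ω := by
  rw [euclNorm_eq, Real.sq_sqrt (formInner_self_nonneg ω)]

/-! ## The Hodge star -/

/-- This pairing characterizes the star. It is used from here on in place of the defining sum. -/
theorem formInner_hodgeStar {k l m : ℕ} (h : k + l = m) (ω : Form k m) (β : Form l m) :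
    formInner l m (hodgeStar h ω) β = wedgeTop h ω β := by
  have : formInner l m (hodgeStar h ω) = wedgeTop h ω := by
    refine linearMap_ext_dx fun t ht => ?_
    rw [hodgeStar_eq, map_sum, LinearMap.sum_apply, Finset.sum_eq_single t]
    · simp [formInner_dx_left, coeff_dx_self t ht.injective]
    · intro J hJ hJt
      rw [map_smul, LinearMap.smul_apply, formInner_dx_left,
        coeff_dx_strictMono (mem_incTuples.mp hJ) ht, if_neg hJt, smul_zero]
    · exact fun h => absurd (mem_incTuples.mpr ht) h
  rw [this]

theorem coeff_hodgeStar {k l m : ℕ} (h : k + l = m) (ω : Form k m) (t : Fin l → Fin m) :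
    coeff t (hodgeStar h ω) = wedgeTop h ω (dx t) := by
  rw [← formInner_hodgeStar, formInner_dx_right]

/-- Wedging with `dx t` kills every `dx r` that meets `t`. The increasing `r` that misses `t` is a
rearrangement of the complement `s`. -/
theorem wedgeTop_dx_right {k l m : ℕ} (h : k + l = m) (ω : Form k m) (s : Fin k → Fin m)
    (t : Fin l → Fin m) (hst : Function.Injective (Fin.append s t)) :
    wedgeTop h ω (dx t) = signTuple (Fin.append s t) * coeff s ω := by
  have hs : Function.Injective s := fun a b hab => by
    have := @hst (Fin.castAdd l a) (Fin.castAdd l b) (by simpa using hab)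
    simpa [Fin.ext_iff] using this
  have ht : Function.Injective t := fun a b hab => by
    have := @hst (Fin.natAdd k a) (Fin.natAdd k b) (by simpa using hab)
    simpa [Fin.ext_iff] using this
  have hd : ∀ a b, s a ≠ t b := fun a b hab => by
    have := @hst (Fin.castAdd l a) (Fin.natAdd k b) (by simpa using hab)
    simp [Fin.ext_iff] at this
    omega
  have hsurj : Function.Surjective (Fin.append s t) := by
    subst h
    exact (Finite.injective_iff_surjective).mp hst
  have : (wedgeTop h).flip (dx t) = ((signTuple (Fin.append s t) : ℤ) : ℝ) • coeff s := by
    refine linearMap_ext_dx fun r hr => ?_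
    rw [LinearMap.flip_apply, LinearMap.smul_apply, smul_eq_mul]
    by_cases hrt : ∃ a b, r a = t b
    · obtain ⟨a, b, hab⟩ := hrt
      rw [coeff_dx_eq_zero_right a (fun c hc => hd c b (by rw [← hc, hab])), mul_zero,
        wedgeTop_dx, dx_eq_zero]
      · rfl
      · intro hinj
        have := @hinj (Fin.castAdd l a) (Fin.natAdd k b) (by simpa using hab)
        simp [Fin.ext_iff] at this
        omega
    · push Not at hrt
      obtain ⟨σ, rfl⟩ : ∃ σ : Equiv.Perm (Fin k), r = s ∘ σ := by
        refine exists_perm_of_forall_mem hr.injective fun a => ?_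
        obtain ⟨i, hi⟩ := hsurj (r a)
        revert hi
        refine Fin.addCases (fun i hi => ?_) (fun i hi => ?_) i
        · exact ⟨i, by simpa using hi.symm⟩
        · exact absurd (by simpa using hi.symm) (hrt a i)
      rw [dx_perm, map_smul, LinearMap.smul_apply, map_smul, coeff_dx_self s hs, wedgeTop_dx,
        topCoeff_dx, smul_eq_mul, smul_eq_mul]
      ring
  exact congrArg (fun f : Form k m →ₗ[ℝ] ℝ => f ω) this

theorem coeff_hodgeStar_eq {k l m : ℕ} (h : k + l = m) (ω : Form k m) (s : Fin k → Fin m)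
    (t : Fin l → Fin m) (hst : Function.Injective (Fin.append s t)) :
    coeff t (hodgeStar h ω) = signTuple (Fin.append s t) * coeff s ω := by
  rw [coeff_hodgeStar, wedgeTop_dx_right h ω s t hst]

/-! ## Linear substitutions -/

theorem rotate_apply {k m : ℕ} (g : Matrix (Fin m) (Fin m) ℝ) (ω : Form k m) (v : Fin k → E m) :
    rotate g ω v = ω fun i => Matrix.toEuclideanLin g.transpose (v i) := rfl

/-- The substitution of variables defined by a matrix, as a linear map. -/
def rotateₗ {k m : ℕ} (g : Matrix (Fin m) (Fin m) ℝ) : Form k m →ₗ[ℝ] Form k m where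
  toFun := rotate g
  map_add' _ _ := rfl
  map_smul' _ _ := rfl

theorem rotate_mul {k m : ℕ} (g h : Matrix (Fin m) (Fin m) ℝ) (ω : Form k m) :
    rotate (g * h) ω = rotate g (rotate h ω) := by
  ext v
  simp only [rotate_apply]
  congr 1
  funext i
  simp [Matrix.transpose_mul, Matrix.toLpLin_apply, Matrix.mulVec_mulVec]

theorem rotate_one {k m : ℕ} (ω : Form k m) : rotate 1 ω = ω := by
  ext v
  simp [rotate_apply]

theorem coeff_rotate_dx {k m : ℕ} (g : Matrix (Fin m) (Fin m) ℝ) (s t : Fin k → Fin m) :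
    coeff t (rotate g (dx s)) = (Matrix.of fun a b => g (t a) (s b)).det := by
  rw [coeff_apply, rotate_apply, dx_apply]
  congr 1
  ext a b
  simp [Matrix.toLpLin_apply]

/-- On basis forms both sides are the same minor of `g`, once transposed. -/
theorem formInner_rotate {k m : ℕ} (g : Matrix (Fin m) (Fin m) ℝ) (α β : Form k m) :
    formInner k m (rotate g α) β = formInner k m α (rotate g.transpose β) := by
  have : (formInner k m) ∘ₗ rotateₗ g = (formInner k m).compl₁₂ LinearMap.id (rotateₗ g.transpose) := by
    refine linearMap_ext_dx fun s _ => linearMap_ext_dx fun t _ => ?_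
    change formInner k m (rotate g (dx s)) (dx t) = formInner k m (dx s) (rotate g.transpose (dx t))
    rw [formInner_dx_left, formInner_dx_right, coeff_rotate_dx, coeff_rotate_dx,
      ← Matrix.det_transpose]
    rfl
  exact congrArg (fun f : Form k m →ₗ[ℝ] Form k m →ₗ[ℝ] ℝ => f α β) this

theorem wedge_rotate {k l m : ℕ} (g : Matrix (Fin m) (Fin m) ℝ) (α : Form k m) (β : Form l m) :
    wedge (rotate g α) (rotate g β) = rotate g (wedge α β) := by
  ext v
  simp only [wedge, rotate_apply, AlternatingMap.domDomCongr_apply,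
    LinearMap.compAlternatingMap_apply, AlternatingMap.domCoprod_apply, map_sum, sum_apply]
  refine Finset.sum_congr rfl fun σ _ => ?_
  -- The sum runs over classes of permutations. On a representative the two summands agree by
  -- definition.
  refine Quotient.inductionOn' σ fun σ => ?_
  rfl

theorem topCoeff_rotate {k m : ℕ} (h : k = m) (g : Matrix (Fin m) (Fin m) ℝ) (η : Form k m) :
    topCoeff h (rotate g η) = g.det * topCoeff h η := by
  subst h
  have : coeff id ∘ₗ rotateₗ g = g.det • (coeff id : Form k k →ₗ[ℝ] ℝ) := by
    refine linearMap_ext_dx fun t ht => ?_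
    have : t = id := strictMono_unique ht strictMono_id fun a => ⟨t a, rfl⟩
    subst this
    change coeff id (rotate g (dx id)) = g.det * coeff id (dx id)
    rw [coeff_rotate_dx, coeff_dx_self _ Function.injective_id, mul_one]
    rfl
  exact congrArg (fun f : Form k k →ₗ[ℝ] ℝ => f η) this

theorem wedgeTop_rotate {k l m : ℕ} (h : k + l = m) (g : Matrix (Fin m) (Fin m) ℝ)
    (α : Form k m) (β : Form l m) :
    wedgeTop h (rotate g α) (rotate g β) = g.det * wedgeTop h α β := by
  rw [wedgeTop_apply, wedge_rotate, topCoeff_rotate, wedgeTop_apply]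

theorem formInner_rotate_self {k m : ℕ} {g : Matrix (Fin m) (Fin m) ℝ}
    (hg : g.transpose * g = 1) (α β : Form k m) :
    formInner k m (rotate g α) (rotate g β) = formInner k m α β := by
  rw [formInner_rotate, ← rotate_mul, hg, rotate_one]

theorem form_ext_formInner {k m : ℕ} {α β : Form k m}
    (h : ∀ γ, formInner k m α γ = formInner k m β γ) : α = β :=
  form_ext_coeff fun t _ => by rw [← formInner_dx_right, ← formInner_dx_right, h]

/-- The star is determined by the inner product and the top coefficient. The first is invariant
under orthogonal `g`, the second because `det g = 1`. -/
theorem hodgeStar_rotate {k l m : ℕ} (h : k + l = m) {g : Matrix (Fin m) (Fin m) ℝ}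
    (hg : g.transpose * g = 1) (hdet : g.det = 1) (ω : Form k m) :
    hodgeStar h (rotate g ω) = rotate g (hodgeStar h ω) := by
  refine form_ext_formInner fun γ => ?_
  have hg' : g * g.transpose = 1 := mul_eq_one_comm.mp hg
  have : γ = rotate g (rotate g.transpose γ) := by rw [← rotate_mul, hg', rotate_one]
  rw [this, formInner_hodgeStar, wedgeTop_rotate, hdet, one_mul, formInner_rotate_self hg,
    formInner_hodgeStar]

/-! ## The comass -/

theorem continuous_form {k m : ℕ} (ω : Form k m) : Continuous fun v : Fin k → E m => ω v := by
  have h : (fun v : Fin k → E m => ω v) = fun v => ∑ J ∈ incTuples k m,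
      coeff J ω * (Matrix.of fun a b => v a (J b)).det := by
    funext v
    conv_lhs => rw [form_eq_sum_incTuples ω]
    rw [form_sum_apply]
    rfl
  rw [h]
  refine continuous_finsetSum _ fun J _ => continuous_const.mul (Continuous.matrix_det ?_)
  refine continuous_matrix fun a b => ?_
  simp only [Matrix.of_apply]
  fun_prop

/-- A form as a continuous multilinear map. -/
def formCMM {k m : ℕ} (ω : Form k m) : ContinuousMultilinearMap ℝ (fun _ : Fin k => E m) ℝ :=
  ⟨ω.toMultilinearMap, continuous_form ω⟩

/-- The operator norm is a bound. This is what makes the `sSup` in the comass meaningful, since an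
unbounded set would have supremum 0. -/
theorem bddAbove_comass {k m : ℕ} (ω : Form k m) :
    BddAbove {r | ∃ v : Fin k → E m, (∀ i, ‖v i‖ = 1) ∧ ω v = r} := by
  refine ⟨‖formCMM ω‖, ?_⟩
  rintro r ⟨v, hv, rfl⟩
  refine (le_abs_self _).trans (((formCMM ω).le_opNorm v).trans ?_)
  simp [hv]

theorem apply_le_comass {k m : ℕ} (ω : Form k m) {v : Fin k → E m} (hv : ∀ i, ‖v i‖ = 1) :
    ω v ≤ comass ω :=
  le_csSup (bddAbove_comass ω) ⟨v, hv, rfl⟩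

/-- Negating the first argument changes the sign of the value, so positive degree is essential here.
-/
theorem abs_apply_le_comass {k m : ℕ} (ω : Form (k + 1) m) {v : Fin (k + 1) → E m}
    (hv : ∀ i, ‖v i‖ = 1) : |ω v| ≤ comass ω := by
  refine abs_le'.mpr ⟨apply_le_comass ω hv, ?_⟩
  have h : ω (Function.update v 0 ((-1 : ℝ) • v 0)) = - ω v := by
    rw [AlternatingMap.map_update_smul, Function.update_eq_self]
    simp
  rw [← h]
  refine apply_le_comass ω fun i => ?_
  by_cases hi : i = 0
  · subst hi
    simp [hv]
  · simp [hi, hv]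

theorem abs_coeff_le_comass {k m : ℕ} (ω : Form (k + 1) m) (t : Fin (k + 1) → Fin m) :
    |coeff t ω| ≤ comass ω :=
  abs_apply_le_comass ω fun i => by simp

theorem comass_pos {k m : ℕ} {ω : Form (k + 1) m} (h : ω ≠ 0) : 0 < comass ω := by
  by_contra hc
  refine h (form_ext_coeff fun t _ => ?_)
  have := (abs_coeff_le_comass ω t).trans (not_lt.mp hc)
  rw [abs_nonpos_iff.mp this, map_zero]

theorem comass_nonneg {k m : ℕ} (ω : Form (k + 1) m) : 0 ≤ comass ω := by
  by_cases h : ∃ v : Fin (k + 1) → E m, ∀ i, ‖v i‖ = 1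
  · obtain ⟨v, hv⟩ := h
    exact (abs_nonneg _).trans (abs_apply_le_comass ω hv)
  -- Without unit vectors (`m = 0`) the comass is `sSup ∅ = 0`.
  · have : {r | ∃ v : Fin (k + 1) → E m, (∀ i, ‖v i‖ = 1) ∧ ω v = r} = ∅ := by
      ext r
      simp only [Set.mem_ofPred_eq, Set.mem_empty_iff_false, iff_false]
      rintro ⟨v, hv, -⟩
      exact h ⟨v, hv⟩
    rw [comass, this, Real.sSup_empty]

theorem norm_toEuclideanLin {m : ℕ} {g : Matrix (Fin m) (Fin m) ℝ} (hg : g.transpose * g = 1)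
    (v : E m) : ‖Matrix.toEuclideanLin g v‖ = ‖v‖ := by
  have h : inner ℝ (Matrix.toEuclideanLin g v) (Matrix.toEuclideanLin g v) = inner ℝ v v := by
    simp only [Matrix.toLpLin_apply, PiLp.inner_apply, RCLike.inner_apply, conj_trivial]
    change (g.mulVec v) ⬝ᵥ (g.mulVec v) = v ⬝ᵥ v
    rw [Matrix.dotProduct_mulVec, Matrix.vecMul_mulVec, hg, Matrix.vecMul_one]
  rw [real_inner_self_eq_norm_sq, real_inner_self_eq_norm_sq] at h
  exact (sq_eq_sq₀ (norm_nonneg _) (norm_nonneg _)).mp h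

theorem comass_rotate {k m : ℕ} {g : Matrix (Fin m) (Fin m) ℝ} (hg : g.transpose * g = 1)
    (ω : Form k m) : comass (rotate g ω) = comass ω := by
  have hg' : g * g.transpose = 1 := mul_eq_one_comm.mp hg
  rw [comass, comass]
  congr 1
  ext r
  constructor
  · rintro ⟨v, hv, rfl⟩
    exact ⟨_, fun i => by
      rw [norm_toEuclideanLin (by rwa [Matrix.transpose_transpose]), hv], rfl⟩
  · rintro ⟨v, hv, rfl⟩
    refine ⟨fun i => Matrix.toEuclideanLin g (v i), fun i => by rw [norm_toEuclideanLin hg, hv], ?_⟩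
    rw [rotate_apply]
    congr 1
    funext i
    simp [Matrix.toLpLin_apply, Matrix.mulVec_mulVec, hg]

/-! ## Rotations and critical points -/

/-- The rotation by the angle `θ` in the plane of the `p`-th and the `q`-th axis. -/
def planeRotation {m : ℕ} (p q : Fin m) (θ : ℝ) : Matrix (Fin m) (Fin m) ℝ :=
  1 + Real.sin θ • (Matrix.single p q 1 - Matrix.single q p 1) +
    (Real.cos θ - 1) • (Matrix.single p p 1 + Matrix.single q q 1)

theorem planeRotation_transpose {m : ℕ} (p q : Fin m) (θ : ℝ) :
    (planeRotation p q θ).transpose = planeRotation p q (-θ) := by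
  simp only [planeRotation, Real.sin_neg, Real.cos_neg, Matrix.transpose_add, Matrix.transpose_one,
    Matrix.transpose_smul, Matrix.transpose_sub, Matrix.transpose_single, neg_smul, ← smul_neg,
    neg_sub]

/-- In the algebra spanned by `1`, `A`, `P`, the projection `P` onto the plane acts as a unit on `A`
and `P`, and `A` as an imaginary unit: `A² = -P`. What remains are the addition formulas. -/
theorem planeRotation_mul {m : ℕ} {p q : Fin m} (hpq : p ≠ q) (θ φ : ℝ) :
    planeRotation p q θ * planeRotation p q φ = planeRotation p q (θ + φ) := by
  simp only [planeRotation, Real.sin_add, Real.cos_add]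
  set A : Matrix (Fin m) (Fin m) ℝ := Matrix.single p q 1 - Matrix.single q p 1
  set P : Matrix (Fin m) (Fin m) ℝ := Matrix.single p p 1 + Matrix.single q q 1
  have hAA : A * A = -P := by
    simp [A, P, sub_mul, mul_sub, hpq, hpq.symm]
    abel
  have hAP : A * P = A := by
    simp [A, P, sub_mul, mul_add, hpq, hpq.symm]
    abel
  have hPA : P * A = A := by
    simp [A, P, mul_sub, add_mul, hpq, hpq.symm]
  have hPP : P * P = P := by
    simp [P, mul_add, add_mul, hpq, hpq.symm]
  simp only [add_mul, mul_add, one_mul, mul_one, smul_mul_assoc, mul_smul_comm, hAA, hAP, hPA, hPP]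
  module

theorem planeRotation_zero {m : ℕ} (p q : Fin m) : planeRotation p q 0 = 1 := by
  simp [planeRotation]

theorem planeRotation_orthogonal {m : ℕ} {p q : Fin m} (hpq : p ≠ q) (θ : ℝ) :
    (planeRotation p q θ).transpose * planeRotation p q θ = 1 := by
  rw [planeRotation_transpose, planeRotation_mul hpq, neg_add_cancel, planeRotation_zero]

theorem mem_specialOrthogonal {m : ℕ} {g : Matrix (Fin m) (Fin m) ℝ} :
    g ∈ Matrix.specialOrthogonalGroup (Fin m) ℝ ↔ g.transpose * g = 1 ∧ g.det = 1 := by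
  rw [Matrix.mem_specialOrthogonalGroup_iff, Matrix.mem_orthogonalGroup_iff']

theorem planeRotation_mem {m : ℕ} {p q : Fin m} (hpq : p ≠ q) (θ : ℝ) :
    planeRotation p q θ ∈ Matrix.specialOrthogonalGroup (Fin m) ℝ := by
  refine mem_specialOrthogonal.mpr ⟨planeRotation_orthogonal hpq θ, ?_⟩
  -- Orthogonality only gives determinant ±1. The sign is settled by writing the rotation as the
  -- square of the half-angle one.
  have h1 : (planeRotation p q (θ / 2)).det * (planeRotation p q (θ / 2)).det = 1 := by
    have := congrArg Matrix.det (planeRotation_orthogonal hpq (θ / 2))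
    rwa [Matrix.det_mul, Matrix.det_transpose, Matrix.det_one] at this
  rw [← add_halves θ, ← planeRotation_mul hpq, Matrix.det_mul, h1]

/-- Differentiating a multilinear map along a curve changes one argument at a time. This turns the
group action into the derivation action of the tangent matrix `E_pq - E_qp`. -/
theorem hasDerivAt_rotate {k m : ℕ} (p q : Fin m) (ω : Form k m) (v : Fin k → E m) :
    HasDerivAt (fun θ => rotate (planeRotation p q θ) ω v)
      (slAct (Matrix.single p q 1 - Matrix.single q p 1) ω v) 0 := by
  set A : Matrix (Fin m) (Fin m) ℝ := Matrix.single p q 1 - Matrix.single q p 1 with hA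
  set P : Matrix (Fin m) (Fin m) ℝ := Matrix.single p p 1 + Matrix.single q q 1 with hP
  let c : ℝ → Fin k → E m := fun θ i => v i + Real.sin θ • Matrix.toEuclideanLin A.transpose (v i) +
    (Real.cos θ - 1) • Matrix.toEuclideanLin P.transpose (v i)
  have hc : HasDerivAt c (fun i => Matrix.toEuclideanLin A.transpose (v i)) 0 := by
    refine hasDerivAt_pi.mpr fun i => ?_
    have h1 := (Real.hasDerivAt_sin 0).smul_const (Matrix.toEuclideanLin A.transpose (v i))
    have h2 := ((Real.hasDerivAt_cos 0).sub_const 1).smul_const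
      (Matrix.toEuclideanLin P.transpose (v i))
    have h3 := (h1.const_add (v i)).add h2
    simp only [Real.cos_zero, Real.sin_zero, neg_zero, zero_smul, add_zero, one_smul] at h3
    exact h3
  have hc0 : c 0 = v := by
    funext i
    simp [c]
  have h := ((formCMM ω).hasStrictFDerivAt (c 0)).hasFDerivAt.comp_hasDerivAt (0 : ℝ) hc
  rw [hc0, ContinuousMultilinearMap.linearDeriv_apply] at h
  rw [slAct_apply]
  refine h.congr_of_eventuallyEq (Filter.Eventually.of_forall fun θ => ?_)
  change ω _ = ω (c θ)
  congr 1
  funext i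
  simp only [c, planeRotation, ← hA, ← hP, Matrix.transpose_add, Matrix.transpose_one,
    Matrix.transpose_smul, map_add, map_smul, LinearMap.add_apply, LinearMap.smul_apply]
  congr 2
  simp

theorem isCompact_specialOrthogonal (m : ℕ) :
    IsCompact (Matrix.specialOrthogonalGroup (Fin m) ℝ : Set (Matrix (Fin m) (Fin m) ℝ)) := by
  refine IsCompact.of_isClosed_subset (s := Set.univ.pi fun _ => Set.univ.pi fun _ => Set.Icc (-1) 1)
    (isCompact_univ_pi fun _ => isCompact_univ_pi fun _ => isCompact_Icc) ?_ ?_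
  · have : (Matrix.specialOrthogonalGroup (Fin m) ℝ : Set (Matrix (Fin m) (Fin m) ℝ)) =
        {g | g.transpose * g = 1} ∩ {g | g.det = 1} := by
      ext g
      exact mem_specialOrthogonal
    rw [this]
    exact (isClosed_eq (by fun_prop) continuous_const).inter
      (isClosed_eq (by fun_prop) continuous_const)
  · intro g hg i _ j _
    have := entry_norm_bound_of_unitary
      (Matrix.mem_specialOrthogonalGroup_iff.mp hg).1 i j
    exact abs_le.mp this

theorem continuous_rotate {k m : ℕ} (ω : Form k m) (v : Fin k → E m) :
    Continuous fun g : Matrix (Fin m) (Fin m) ℝ => rotate g ω v := by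
  refine (continuous_form ω).comp (continuous_pi fun i => ?_)
  simp only [Matrix.toLpLin_apply]
  refine (PiLp.continuous_toLp 2 _).comp ?_
  fun_prop

/-- A linear functional of evaluations has a maximum on the orbit of a form under rotations, and the
maximum is a critical point. -/
theorem exists_rotate_critical {k m : ℕ} {ι : Type*} (s : Finset ι) (c : ι → ℝ)
    (v : ι → Fin k → E m) (ω : Form k m) :
    ∃ g ∈ Matrix.specialOrthogonalGroup (Fin m) ℝ, ∀ p q : Fin m, p ≠ q →
      ∑ i ∈ s, c i *
        slAct (Matrix.single p q 1 - Matrix.single q p 1) (rotate g ω) (v i) = 0 := by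
  obtain ⟨g, hg, hmax⟩ := (isCompact_specialOrthogonal m).exists_isMaxOn ⟨1, one_mem _⟩
    (f := fun g => ∑ i ∈ s, c i * rotate g ω (v i))
    (continuous_finsetSum _ fun i _ => continuous_const.mul (continuous_rotate ω (v i))).continuousOn
  refine ⟨g, hg, fun p q hpq => ?_⟩
  have hd : HasDerivAt (fun θ => ∑ i ∈ s, c i * rotate (planeRotation p q θ) (rotate g ω) (v i))
      (∑ i ∈ s, c i * slAct (Matrix.single p q 1 - Matrix.single q p 1) (rotate g ω) (v i)) 0 :=
    HasDerivAt.fun_sum fun i _ => (hasDerivAt_rotate p q (rotate g ω) (v i)).const_mul (c i)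
  refine IsLocalMax.hasDerivAt_eq_zero (Filter.Eventually.of_forall fun θ => ?_) hd
  simp only [planeRotation_zero, one_mul, ← rotate_mul]
  exact hmax (mul_mem (planeRotation_mem hpq θ) hg)

theorem toEuclideanLin_transpose_stdVec {m : ℕ} (A : Matrix (Fin m) (Fin m) ℝ) (i : Fin m) :
    Matrix.toEuclideanLin A.transpose (stdVec i) = ∑ j, A i j • stdVec j := by
  ext j
  simp [Matrix.toLpLin_apply, Pi.single_apply]

theorem coeff_slAct {k m : ℕ} (A : Matrix (Fin m) (Fin m) ℝ) (ω : Form k m) (t : Fin k → Fin m) :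
    coeff t (slAct A ω) = ∑ i, ∑ p, A (t i) p * coeff (Function.update t i p) ω := by
  rw [coeff_apply, slAct_apply]
  refine Finset.sum_congr rfl fun i _ => ?_
  rw [toEuclideanLin_transpose_stdVec, AlternatingMap.map_update_sum]
  refine Finset.sum_congr rfl fun p _ => ?_
  rw [AlternatingMap.map_update_smul, smul_eq_mul, coeff_apply]
  congr 2
  funext j
  by_cases hj : j = i
  · subst hj; simp
  · simp [hj]

theorem coeff_slAct_single {k m : ℕ} (p q : Fin m) (ω : Form k m) (t : Fin k → Fin m) :
    coeff t (slAct (Matrix.single p q 1) ω) =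
      ∑ i, if t i = p then coeff (Function.update t i q) ω else 0 := by
  rw [coeff_slAct]
  refine Finset.sum_congr rfl fun i _ => ?_
  rw [Finset.sum_eq_single q]
  · by_cases h : t i = p
    · simp [h]
    · simp [h, Ne.symm h]
  · intro b _ hb
    simp [hb.symm]
  · simp

/-! ## The fourteen multi-indices of the Cayley form -/

/-- The seven multi-indices of the Cayley form that contain the first axis. -/
def cw : Fin 7 → Fin 4 → Fin 8 :=
  ![![0, 1, 2, 3], ![0, 1, 4, 5], ![0, 1, 6, 7], ![0, 2, 4, 6], ![0, 3, 5, 6], ![0, 2, 5, 7],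
    ![0, 3, 4, 7]]

/-- The complements of the `cw i`. -/
def cwCompl : Fin 7 → Fin 4 → Fin 8 :=
  ![![4, 5, 6, 7], ![2, 3, 6, 7], ![2, 3, 4, 5], ![1, 3, 5, 7], ![1, 2, 4, 7], ![1, 3, 4, 6],
    ![1, 2, 5, 6]]

/-- The fourteen multi-indices. -/
def codeword (b : Bool) (i : Fin 7) : Fin 4 → Fin 8 := if b then cw i else cwCompl i

/-- This is why the star swaps complementary blocks without a sign, and why each `sdBasis i` is a
plain sum. -/
theorem signTuple_codeword : ∀ b i, signTuple (Fin.append (codeword (!b) i) (codeword b i)) = 1 := by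
  decide +kernel

theorem codeword_strictMono (b : Bool) (i : Fin 7) : StrictMono (codeword b i) := by
  refine strictMono_four _ ?_
  revert b i
  decide +kernel

theorem codeword_inj : ∀ b i b' i', codeword b i = codeword b' i' ↔ b = b' ∧ i = i' := by
  decide +kernel

theorem append_codeword_injective :
    ∀ b i, Function.Injective (Fin.append (codeword (!b) i) (codeword b i)) := by
  decide +kernel

theorem hodgeStar_dx (s t : Fin 4 → Fin 8) (h : Function.Injective (Fin.append t s)) :
    hodgeStar four_add_four (dx s) = ((signTuple (Fin.append t s) : ℤ) : ℝ) • dx t := by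
  refine form_ext_formInner fun γ => ?_
  rw [formInner_hodgeStar, wedgeTop_comm, wedgeTop_dx_right four_add_four γ t s h, map_smul,
    LinearMap.smul_apply, formInner_dx_left, smul_eq_mul]

theorem hodgeStar_dx_codeword (b : Bool) (i : Fin 7) :
    hodgeStar four_add_four (dx (codeword b i)) = dx (codeword (!b) i) := by
  rw [hodgeStar_dx _ _ (append_codeword_injective b i), signTuple_codeword]
  simp

/-- The seven self-dual forms whose signed sum is the Cayley form. -/
def sdBasis (i : Fin 7) : Form 4 8 := dx (codeword true i) + dx (codeword false i)

theorem sdForm_eq (i : Fin 7) : sdForm (cw i 0) (cw i 1) (cw i 2) (cw i 3) = sdBasis i := by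
  have : ![cw i 0, cw i 1, cw i 2, cw i 3] = codeword true i := by
    revert i
    decide +kernel
  rw [sdForm, this, hodgeStar_dx_codeword]
  rfl

theorem cayleySpan_eq : cayleySpan = Submodule.span ℝ (Set.range sdBasis) := by
  have : sdBasis = fun i => sdForm (cw i 0) (cw i 1) (cw i 2) (cw i 3) :=
    funext fun i => (sdForm_eq i).symm
  rw [cayleySpan, this]
  congr 1
  refine subset_antisymm ?_ ?_
  · rintro ω (rfl | rfl | rfl | rfl | rfl | rfl | rfl)
    exacts [⟨0, rfl⟩, ⟨1, rfl⟩, ⟨2, rfl⟩, ⟨3, rfl⟩, ⟨4, rfl⟩, ⟨5, rfl⟩, ⟨6, rfl⟩]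
  · rintro _ ⟨i, rfl⟩
    match i with
    | 0 => exact Or.inl rfl
    | 1 => exact Or.inr (Or.inl rfl)
    | 2 => exact Or.inr (Or.inr (Or.inl rfl))
    | 3 => exact Or.inr (Or.inr (Or.inr (Or.inl rfl)))
    | 4 => exact Or.inr (Or.inr (Or.inr (Or.inr (Or.inl rfl))))
    | 5 => exact Or.inr (Or.inr (Or.inr (Or.inr (Or.inr (Or.inl rfl)))))
    | 6 => exact Or.inr (Or.inr (Or.inr (Or.inr (Or.inr (Or.inr rfl)))))

theorem cayley_eq : cayley = sdBasis 0 + sdBasis 1 + sdBasis 2 + sdBasis 3 - sdBasis 4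
    - sdBasis 5 - sdBasis 6 := by
  have h0 : sdForm 0 1 2 3 = sdBasis 0 := sdForm_eq 0
  have h1 : sdForm 0 1 4 5 = sdBasis 1 := sdForm_eq 1
  have h2 : sdForm 0 1 6 7 = sdBasis 2 := sdForm_eq 2
  have h3 : sdForm 0 2 4 6 = sdBasis 3 := sdForm_eq 3
  have h4 : sdForm 0 3 5 6 = sdBasis 4 := sdForm_eq 4
  have h5 : sdForm 0 2 5 7 = sdBasis 5 := sdForm_eq 5
  have h6 : sdForm 0 3 4 7 = sdBasis 6 := sdForm_eq 6
  rw [cayley, h0, h1, h2, h3, h4, h5, h6]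

theorem coeff_codeword_dx (b b' : Bool) (i j : Fin 7) :
    coeff (codeword b i) (dx (codeword b' j)) = if b = b' ∧ i = j then 1 else 0 := by
  rw [coeff_dx_strictMono (codeword_strictMono b i) (codeword_strictMono b' j)]
  exact if_congr (codeword_inj b i b' j) rfl rfl

theorem coeff_codeword_sdBasis (b : Bool) (i j : Fin 7) :
    coeff (codeword b i) (sdBasis j) = if i = j then 1 else 0 := by
  rw [sdBasis, map_add, coeff_codeword_dx, coeff_codeword_dx]
  cases b <;> simp

theorem coeff_codeword_not {ω : Form 4 8} (hω : ω ∈ cayleySpan) (b : Bool) (i : Fin 7) :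
    coeff (codeword (!b) i) ω = coeff (codeword b i) ω := by
  rw [cayleySpan_eq] at hω
  refine Submodule.span_le (p := LinearMap.eqLocus (coeff (codeword (!b) i)) (coeff (codeword b i)))
    |>.mpr ?_ hω
  rintro _ ⟨j, rfl⟩
  change coeff _ _ = coeff _ _
  rw [coeff_codeword_sdBasis, coeff_codeword_sdBasis]

theorem coeff_eq_zero_of_mem {ω : Form 4 8} (hω : ω ∈ cayleySpan) {t : Fin 4 → Fin 8}
    (h : ∀ b i, ∃ a, ∀ c, t a ≠ codeword b i c) : coeff t ω = 0 := by
  rw [cayleySpan_eq] at hω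
  refine Submodule.span_le (p := LinearMap.ker (coeff t)) |>.mpr ?_ hω
  rintro _ ⟨j, rfl⟩
  obtain ⟨a, ha⟩ := h true j
  obtain ⟨a', ha'⟩ := h false j
  exact LinearMap.mem_ker.mpr (by
    rw [sdBasis, map_add, coeff_dx_eq_zero_left a ha, coeff_dx_eq_zero_left a' ha', add_zero])

theorem coeff_eq_zero_of_mem_of_ne {ω : Form 4 8} (hω : ω ∈ cayleySpan) {t : Fin 4 → Fin 8}
    (ht : StrictMono t) (h : ∀ b i, t ≠ codeword b i) : coeff t ω = 0 := by
  refine coeff_eq_zero_of_mem hω fun b i => ?_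
  by_contra hc
  push Not at hc
  exact h b i (strictMono_unique ht (codeword_strictMono b i) hc)

theorem eq_sum_sdBasis {ω : Form 4 8}
    (h0 : ∀ t : Fin 4 → Fin 8, StrictMono t → (∀ b i, t ≠ codeword b i) → coeff t ω = 0)
    (h1 : ∀ i, coeff (codeword false i) ω = coeff (codeword true i) ω) :
    ω = ∑ i, coeff (codeword true i) ω • sdBasis i := by
  refine form_ext_coeff fun t ht => ?_
  rw [map_sum]
  simp only [map_smul, smul_eq_mul]
  by_cases hc : ∀ b i, t ≠ codeword b i
  · rw [h0 t ht hc, Finset.sum_eq_zero]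
    intro i _
    rw [coeff_eq_zero_of_mem_of_ne (cayleySpan_eq ▸ Submodule.subset_span ⟨i, rfl⟩) ht hc, mul_zero]
  · push Not at hc
    obtain ⟨b, i, rfl⟩ := hc
    simp only [coeff_codeword_sdBasis]
    cases b <;> simp [h1]

theorem mem_cayleySpan {ω : Form 4 8}
    (h0 : ∀ t : Fin 4 → Fin 8, StrictMono t → (∀ b i, t ≠ codeword b i) → coeff t ω = 0)
    (h1 : ∀ i, coeff (codeword false i) ω = coeff (codeword true i) ω) : ω ∈ cayleySpan := by
  rw [eq_sum_sdBasis h0 h1, cayleySpan_eq]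
  exact Submodule.sum_mem _ fun i _ => Submodule.smul_mem _ _ (Submodule.subset_span ⟨i, rfl⟩)

theorem eq_sum_sdBasis_of_mem {ω : Form 4 8} (hω : ω ∈ cayleySpan) :
    ω = ∑ i, coeff (codeword true i) ω • sdBasis i :=
  eq_sum_sdBasis (fun _ ht => coeff_eq_zero_of_mem_of_ne hω ht) (coeff_codeword_not hω true)

/-! ### Self-duality, dimension and norms on the span -/

theorem sdBasis_mem_selfDual (i : Fin 7) : sdBasis i ∈ selfDual := by
  change hodgeStarₗ four_add_four (sdBasis i) = sdBasis i
  rw [sdBasis, map_add]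
  change hodgeStar four_add_four _ + hodgeStar four_add_four _ = _
  rw [hodgeStar_dx_codeword, hodgeStar_dx_codeword, add_comm]
  rfl

theorem cayleySpan_le_selfDual : cayleySpan ≤ selfDual := by
  rw [cayleySpan_eq, Submodule.span_le]
  rintro _ ⟨i, rfl⟩
  exact sdBasis_mem_selfDual i

theorem sdBasis_mem (i : Fin 7) : sdBasis i ∈ cayleySpan :=
  cayleySpan_eq ▸ Submodule.subset_span ⟨i, rfl⟩

theorem cayley_mem : cayley ∈ cayleySpan := by
  rw [cayley_eq]
  have := sdBasis_mem
  exact sub_mem (sub_mem (sub_mem (add_mem (add_mem (add_mem (this _) (this _)) (this _)) (this _))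
    (this _)) (this _)) (this _)

theorem finrank_cayleySpan : Module.finrank ℝ cayleySpan = 7 := by
  have h : LinearIndependent ℝ sdBasis := by
    rw [Fintype.linearIndependent_iff]
    intro c hc i
    have := congrArg (coeff (codeword true i)) hc
    rw [map_sum, map_zero] at this
    simpa [coeff_codeword_sdBasis] using this
  rw [cayleySpan_eq, finrank_span_eq_card h, Fintype.card_fin]

theorem formInner_of_mem {ω : Form 4 8} (hω : ω ∈ cayleySpan) (α : Form 4 8) :
    formInner 4 8 α ω = ∑ i, coeff (codeword true i) ω *
      (coeff (codeword true i) α + coeff (codeword false i) α) := by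
  conv_lhs => rw [eq_sum_sdBasis_of_mem hω]
  simp [map_sum, sdBasis, formInner_dx_right, mul_add]

theorem wedgeTop_of_selfDual {ω : Form 4 8} (hω : ω ∈ selfDual) (α : Form 4 8) :
    wedgeTop four_add_four α ω = formInner 4 8 α ω := by
  rw [wedgeTop_comm, ← formInner_hodgeStar, (mem_selfDual ω).mp hω, formInner_comm]

theorem coeff_of_selfDual {ω : Form 4 8} (hω : ω ∈ selfDual) (s t : Fin 4 → Fin 8)
    (hst : Function.Injective (Fin.append s t)) :
    coeff t ω = signTuple (Fin.append s t) * coeff s ω := by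
  conv_lhs => rw [← (mem_selfDual ω).mp hω]
  exact coeff_hodgeStar_eq four_add_four ω s t hst

theorem formInner_self_of_mem {ω : Form 4 8} (hω : ω ∈ cayleySpan) :
    formInner 4 8 ω ω = 2 * ∑ i, coeff (codeword true i) ω ^ 2 := by
  rw [formInner_of_mem hω, Finset.mul_sum]
  refine Finset.sum_congr rfl fun i _ => ?_
  have := coeff_codeword_not hω true i
  rw [Bool.not_true] at this
  rw [this]
  ring

theorem euclNorm_cayley : euclNorm cayley ^ 2 = 14 := by
  have h : ∀ i, coeff (codeword true i) cayley ^ 2 = 1 := by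
    intro i
    rw [cayley_eq]
    simp only [map_add, map_sub, coeff_codeword_sdBasis]
    fin_cases i <;> simp
  rw [euclNorm_sq, formInner_self_of_mem cayley_mem]
  simp only [h]
  norm_num

/-! ## The Lie algebra generated by the seven forms -/

/-- Two different blocks share at most two axes. A block with one axis replaced by an outside one
keeps three of its axes, so it is not contained in any block. -/
theorem codeword_far : ∀ b i l p, (∀ a, p ≠ codeword b i a) →
    ∀ b' i', ∃ a, ∀ c, Function.update (codeword b i) l p a ≠ codeword b' i' c := by
  decide +kernel

theorem coeff_near_codeword {ω : Form 4 8} (hω : ω ∈ cayleySpan) (b : Bool) (i : Fin 7) (l : Fin 4)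
    (p : Fin 8) (hp : p ≠ codeword b i l) :
    coeff (Function.update (codeword b i) l p) ω = 0 := by
  by_cases h : ∀ a, p ≠ codeword b i a
  · exact coeff_eq_zero_of_mem hω (codeword_far b i l p h)
  · push Not at h
    obtain ⟨a, ha⟩ := h
    have hal : a ≠ l := by
      rintro rfl
      exact hp ha
    refine coeff_eq_zero (fun hinj => hal (hinj ?_)) ω
    rw [Function.update_self, Function.update_of_ne hal, ha]

/-- A derivation moves one axis at a time, and a block with one axis moved carries no coefficient of
`ω`. Only the diagonal entries of `A` contribute. -/
theorem coeff_codeword_slAct {ω : Form 4 8} (hω : ω ∈ cayleySpan) (A : Matrix (Fin 8) (Fin 8) ℝ)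
    (b : Bool) (i : Fin 7) : coeff (codeword b i) (slAct A ω) =
      (∑ a, A (codeword b i a) (codeword b i a)) * coeff (codeword b i) ω := by
  rw [coeff_slAct, Finset.sum_mul]
  refine Finset.sum_congr rfl fun a _ => ?_
  rw [Finset.sum_eq_single (codeword b i a)]
  · rw [Function.update_eq_self]
  · intro p _ hp
    rw [coeff_near_codeword hω b i a p hp, mul_zero]
  · simp

theorem sum_codeword (f : Fin 8 → ℝ) (i : Fin 7) :
    ∑ a, f (codeword true i a) + ∑ a, f (codeword false i a) = ∑ j, f j := by
  have h := append_codeword_injective false i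
  have hb : Function.Bijective (Fin.append (codeword true i) (codeword false i)) :=
    Finite.injective_iff_bijective.mp h
  rw [← hb.sum_comp f]
  change _ = ∑ a : Fin (4 + 4), _
  simp only [Fin.sum_univ_add, Fin.append_left, Fin.append_right]

/-- By the trace pairing it is enough that `⟨A·α, β⟩ = 0` for traceless `A`. Complementary blocks
carry equal coefficients of `α` and of `β`, and their partial traces of `A` sum to zero. -/
theorem kappaMat_of_mem {α β : Form 4 8} (hα : α ∈ cayleySpan) (hβ : β ∈ cayleySpan) :
    kappaMat four_add_four α β = 0 := by
  refine eq_of_trace_mul (trace_kappaMat _ _ _) fun A hA => ?_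
  rw [trace_mul_kappaMat, hA, zero_mul, sub_zero,
    wedgeTop_of_selfDual (cayleySpan_le_selfDual hβ), formInner_of_mem hβ]
  refine Finset.sum_eq_zero fun i _ => ?_
  have h := coeff_codeword_not hα true i
  rw [Bool.not_true] at h
  have hs := sum_codeword (fun j => A j j) i
  rw [show ∑ j, A j j = 0 from hA] at hs
  rw [coeff_codeword_slAct hα, coeff_codeword_slAct hα, h, ← add_mul, hs, zero_mul, mul_zero]

theorem lie_ofForm (α β : Form 4 8) : ⁅E7.ofForm α, E7.ofForm β⁆ = (kappa α β, (0 : Form 4 8)) := by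
  refine E7.ext_iff_val ?_ ?_
  · rw [E7.lie_fst]
    change (0 : Matrix (Fin 8) (Fin 8) ℝ) * 0 - 0 * 0 + _ = _
    simp
    rfl
  · rw [E7.lie_snd]
    change slActₗ 4 8 0 β - slActₗ 4 8 0 α = 0
    simp

theorem isAbelian_cayleySpan : IsAbelianInE7 cayleySpan := by
  intro x hx y hy
  rw [lie_ofForm]
  exact E7.ext_iff_val (kappaMat_of_mem hx hy) rfl

/-! ### Forms commuting with the span -/

/-- Any three axes lie in a block, so the complement of a 4-subset that is not a block arises from a
block by moving one axis. -/
theorem exists_codeword_near : ∀ a b c d : Fin 8, a < b → b < c → c < d →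
    (∀ e i, ![a, b, c, d] ≠ codeword e i) → ∃ e i l p, (∀ x, p ≠ codeword e i x) ∧
      ∀ x y, ![a, b, c, d] x ≠ Function.update (codeword e i) l p y := by
  decide +kernel

theorem signTuple_ne_zero {k m : ℕ} {w : Fin k → Fin m} (hw : Function.Injective w) :
    signTuple w ≠ 0 := by
  refine Finset.prod_ne_zero_iff.mpr fun i _ => Finset.prod_ne_zero_iff.mpr fun j hj => ?_
  rcases lt_trichotomy (w i) (w j) with h | h | h
  · simp [h]
  · exact absurd (hw h) (Finset.mem_Ioi.mp hj).ne
  · simp [h, h.not_gt]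

theorem slAct_single_dx {k m : ℕ} (t : Fin k → Fin m) (ht : Function.Injective t) (l : Fin k)
    (p : Fin m) : slAct (Matrix.single p (t l) 1) (dx t) = dx (Function.update t l p) := by
  rw [slAct_dx, Finset.sum_eq_single l, Finset.sum_eq_single p]
  · simp
  · intro b _ hb
    simp [hb.symm]
  · simp
  · intro b _ hb
    refine Finset.sum_eq_zero fun q _ => ?_
    simp [(ht.ne hb).symm]
  · simp

theorem slAct_diagonal_dx {k m : ℕ} (d : Fin m → ℝ) (t : Fin k → Fin m) :
    slAct (Matrix.diagonal d) (dx t) = (∑ a, d (t a)) • dx t := by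
  rw [slAct_dx, Finset.sum_smul]
  refine Finset.sum_congr rfl fun l _ => ?_
  rw [Finset.sum_eq_single (t l)]
  · rw [Matrix.diagonal_apply_eq, Function.update_eq_self]
  · intro p _ hp
    rw [Matrix.diagonal_apply_ne _ hp, zero_smul]
  · simp

theorem injective_update {α β : Type*} [DecidableEq α] {t : α → β} (ht : Function.Injective t)
    {l : α} {p : β} (hp : ∀ a, p ≠ t a) : Function.Injective (Function.update t l p) := by
  intro a b hab
  by_cases ha : a = l <;> by_cases hb : b = l
  · rw [ha, hb]
  · subst ha
    rw [Function.update_self, Function.update_of_ne hb] at hab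
    exact absurd hab (hp b)
  · subst hb
    rw [Function.update_self, Function.update_of_ne ha] at hab
    exact absurd hab.symm (hp a)
  · rw [Function.update_of_ne ha, Function.update_of_ne hb] at hab
    exact ht hab

theorem codeword_disjoint (b : Bool) (i : Fin 7) (x y : Fin 4) :
    codeword (!b) i x ≠ codeword b i y :=
  (Fin.append_injective_iff.mp (append_codeword_injective b i)).2.2 x y

/-- In top degree a traceless matrix acts by zero, so the Leibniz rule moves `A` from `x` to `y`.
This matters because `y` will be an explicit element of the span. -/
theorem wedgeTop_slAct_eq_zero {x y : Form 4 8} (h : kappaMat four_add_four x y = 0)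
    (A : Matrix (Fin 8) (Fin 8) ℝ) (hA : A.trace = 0) :
    wedgeTop four_add_four x (slAct A y) = 0 := by
  have h1 := trace_mul_kappaMat four_add_four A x y
  have h2 := wedgeTop_slAct four_add_four A x y
  rw [h, mul_zero, Matrix.trace_zero, hA, zero_mul, sub_zero] at h1
  rwa [← h1, hA, zero_mul, zero_add] at h2

theorem sdBasis_eq (b : Bool) (i : Fin 7) :
    sdBasis i = dx (codeword b i) + dx (codeword (!b) i) := by
  cases b
  · exact add_comm _ _
  · rfl

theorem mem_cayleySpan_of_kappaMat {x : Form 4 8}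
    (h : ∀ y ∈ cayleySpan, kappaMat four_add_four x y = 0) : x ∈ cayleySpan := by
  refine mem_cayleySpan (fun t ht hne => ?_) fun i => ?_
  · have ht4 : t = ![t 0, t 1, t 2, t 3] := by
      funext a
      fin_cases a <;> rfl
    obtain ⟨e, i, l, p, hp, hd⟩ := exists_codeword_near (t 0) (t 1) (t 2) (t 3) (ht (by decide))
      (ht (by decide)) (ht (by decide)) (ht4 ▸ hne)
    rw [← ht4] at hd
    have hc := (codeword_strictMono e i).injective
    -- This elementary matrix moves the nearby block to the complement of `t` and kills the
    -- complementary block. The wedge with `x` is then `±` the coefficient of `x` at `t`.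
    have h1 := wedgeTop_slAct_eq_zero (h _ (sdBasis_mem i))
      (Matrix.single p (codeword e i l) 1) (trace_single_of_ne (hp l))
    rw [sdBasis_eq e, slAct_add_right, slAct_single_dx _ hc,
      slAct_single_dx_eq_zero _ _ (codeword (!e) i)
        (fun a ha => absurd ha (codeword_disjoint e i a l)), add_zero,
      wedgeTop_dx_right] at h1
    · refine (mul_eq_zero.mp h1).resolve_left (Int.cast_ne_zero.mpr (signTuple_ne_zero ?_))
      exact Fin.append_injective_iff.mpr ⟨ht.injective, injective_update hc hp, hd⟩
    · exact Fin.append_injective_iff.mpr ⟨ht.injective, injective_update hc hp, hd⟩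
  · let p := codeword true i 0
    let q := codeword false i 0
    -- With `p` in the block and `q` in its complement, this diagonal matrix sends `sdBasis i` to
    -- the difference of its two terms. Wedging with `x` compares the two coefficients.
    let d : Fin 8 → ℝ := Pi.single p 1 - Pi.single q 1
    have hpq : p ≠ q := (codeword_disjoint true i 0 0).symm
    have hd0 : ∑ j, d j = 0 := by simp [d]
    have htr : (Matrix.diagonal d).trace = 0 := by rw [Matrix.trace_diagonal, hd0]
    have hd : ∑ a, d (codeword true i a) = 1 := by
      have h1 := fun a => (codeword_strictMono true i).injective.eq_iff (a := a) (b := 0)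
      have h2 : ∀ a, codeword true i a ≠ codeword false i 0 :=
        fun a => (codeword_disjoint true i 0 a).symm
      simp [d, p, q, Pi.single_apply, h1, h2]
    have h1 := wedgeTop_slAct_eq_zero (h _ (sdBasis_mem i)) _ htr
    have hs := sum_codeword d i
    rw [hd0, hd] at hs
    rw [sdBasis, slAct_add_right, slAct_diagonal_dx, slAct_diagonal_dx, hd,
      eq_neg_of_add_eq_zero_right hs, map_add, map_smul, map_smul,
      wedgeTop_dx_right _ _ _ _ (append_codeword_injective true i),
      wedgeTop_dx_right _ _ _ _ (append_codeword_injective false i), signTuple_codeword,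
      signTuple_codeword] at h1
    simp only [Bool.not_true, Bool.not_false, Int.cast_one, one_mul, one_smul, neg_smul] at h1
    linarith

theorem kappaMat_eq_zero_of_lie {x y : Form 4 8} (h : ⁅E7.ofForm x, E7.ofForm y⁆ = 0) :
    kappaMat four_add_four x y = 0 := by
  rw [lie_ofForm] at h
  exact congrArg (fun X : E7 => X.1.1) h

/-- A form that commutes with the whole span already lies in it, so no abelian subspace can be
larger. -/
theorem maximal_cayleySpan :
    Maximal (fun a : Submodule ℝ (Form 4 8) => a ≤ selfDual ∧ IsAbelianInE7 a) cayleySpan := by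
  refine ⟨⟨cayleySpan_le_selfDual, isAbelian_cayleySpan⟩, fun b hb hle x hx => ?_⟩
  exact mem_cayleySpan_of_kappaMat fun y hy => kappaMat_eq_zero_of_lie (hb.2 x hx y (hle hy))

/-! ## The Cartan subalgebra -/

theorem coeff_update_slAct_sdBasis (A : Matrix (Fin 8) (Fin 8) ℝ) (b : Bool) (i : Fin 7) (l : Fin 4)
    (p : Fin 8) (hp : ∀ a, p ≠ codeword b i a) :
    coeff (Function.update (codeword b i) l p) (slAct A (sdBasis i)) = A p (codeword b i l) := by
  have hc := (codeword_strictMono b i).injective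
  rw [sdBasis_eq b, slAct_add_right, map_add, coeff_slAct, coeff_slAct, Finset.sum_eq_single l,
    Finset.sum_eq_single (codeword b i l)]
  · rw [Function.update_idem, Function.update_eq_self, coeff_dx_self _ hc, Function.update_self,
      mul_one, add_eq_left]
    refine Finset.sum_eq_zero fun j _ => Finset.sum_eq_zero fun r _ => ?_
    -- At most two of the four slots have been changed. A third still holds an axis of the block,
    -- which the complementary block does not contain.
    obtain ⟨a, hal, haj⟩ : ∃ a, a ≠ l ∧ a ≠ j := by
      revert l j
      decide
    rw [coeff_dx_eq_zero_left a, mul_zero]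
    intro c
    rw [Function.update_of_ne haj, Function.update_of_ne hal]
    exact (codeword_disjoint b i c a).symm
  · intro r _ hr
    rw [Function.update_idem, coeff_dx_eq_zero_right l, mul_zero]
    intro a
    by_cases ha : a = l
    · subst ha
      rw [Function.update_self]
      exact hr.symm
    · rw [Function.update_of_ne ha]
      exact hc.ne (Ne.symm ha)
  · simp
  · intro j _ hj
    refine Finset.sum_eq_zero fun r _ => ?_
    rw [coeff_dx_eq_zero_left l, mul_zero]
    intro c
    rw [Function.update_of_ne hj.symm, Function.update_self]
    exact hp c
  · simp

theorem exists_codeword_separating : ∀ p q : Fin 8, p ≠ q → ∃ b i l, codeword b i l = q ∧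
    ∀ a, p ≠ codeword b i a := by
  decide +kernel

/-- An entry `A p q` off the diagonal shows up in `A·y` at a multi-index that is not a block, for a
block containing `q` but not `p`. On the diagonal, equality of the coefficients at complementary
blocks makes every partial trace vanish. -/
theorem eq_zero_of_slAct_mem {A : Matrix (Fin 8) (Fin 8) ℝ} (hA : A.trace = 0)
    (h : ∀ y ∈ cayleySpan, slAct A y ∈ cayleySpan) : A = 0 := by
  have hoff : ∀ p q, p ≠ q → A p q = 0 := by
    intro p q hpq
    obtain ⟨b, i, l, rfl, hp⟩ := exists_codeword_separating p q hpq
    rw [← coeff_update_slAct_sdBasis A b i l p hp]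
    exact coeff_eq_zero_of_mem (h _ (sdBasis_mem i)) (codeword_far b i l p hp)
  have hsum : ∀ i, ∑ a, A (codeword true i a) (codeword true i a) = 0 := by
    intro i
    have h1 := coeff_codeword_not (h _ (sdBasis_mem i)) true i
    rw [coeff_codeword_slAct (sdBasis_mem i), coeff_codeword_slAct (sdBasis_mem i),
      coeff_codeword_sdBasis, coeff_codeword_sdBasis, if_pos rfl, mul_one, mul_one] at h1
    have h2 := sum_codeword (fun j => A j j) i
    rw [show ∑ j, A j j = 0 from hA] at h2
    simp only [Bool.not_true] at h1
    linarith
  have hA' : ∑ j, A j j = 0 := hA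
  have h0 := hsum 0
  have h1 := hsum 1
  have h2 := hsum 2
  have h3 := hsum 3
  have h4 := hsum 4
  have h5 := hsum 5
  have h6 := hsum 6
  -- Any two of the seven blocks `cw i` share exactly two axes. Hence the trace and the differences
  -- `2 Σ_I - tr` have the rows of a Hadamard matrix of order 8 as coefficients, and these eight
  -- equations determine the diagonal.
  simp [codeword, cw, Fin.sum_univ_succ] at h0 h1 h2 h3 h4 h5 h6 hA'
  ext p q
  by_cases hpq : p = q
  · subst hpq
    rw [Matrix.zero_apply]
    fin_cases p <;> simp <;> linarith
  · exact hoff p q hpq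

/-- The span of the seven forms, as a subalgebra of `E₇`. -/
def cayleySubalgebra : LieSubalgebra ℝ E7 where
  toSubmodule := cayleySpan.map E7.ofForm
  lie_mem' := by
    rintro _ _ ⟨x, hx, rfl⟩ ⟨y, hy, rfl⟩
    rw [isAbelian_cayleySpan x hx y hy]
    exact Submodule.zero_mem _

theorem mem_cayleySubalgebra {X : E7} :
    X ∈ cayleySubalgebra ↔ X.1.1 = 0 ∧ X.2 ∈ cayleySpan := by
  constructor
  · rintro ⟨x, hx, rfl⟩
    exact ⟨rfl, hx⟩
  · rintro ⟨h1, h2⟩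
    exact ⟨X.2, h2, E7.ext_iff_val h1.symm rfl⟩

/-- If `X = (A, x)` normalizes the span, the two components of `[X, y]` say that `x` commutes with
every `y` in the span and that `A` preserves the span. Hence `x` lies in the span and `A = 0`. -/
theorem isCartan_cayleySubalgebra : cayleySubalgebra.IsCartanSubalgebra where
  nilpotent := by
    have : IsLieAbelian cayleySubalgebra := ⟨by
      rintro ⟨_, x, hx, rfl⟩ ⟨_, y, hy, rfl⟩
      exact Subtype.ext (isAbelian_cayleySpan x hx y hy)⟩
    infer_instance
  self_normalizing := by
    refine le_antisymm (fun X hX => ?_) (LieSubalgebra.le_normalizer _)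
    rw [LieSubalgebra.mem_normalizer_iff] at hX
    have h : ∀ y ∈ cayleySpan, kappaMat four_add_four X.2 y = 0 ∧ slAct X.1.1 y ∈ cayleySpan := by
      intro y hy
      have := mem_cayleySubalgebra.mp (hX (E7.ofForm y) ⟨y, hy, rfl⟩)
      rw [E7.lie_fst, E7.lie_snd] at this
      change X.1.1 * 0 - 0 * X.1.1 + kappaMat four_add_four X.2 y = 0 ∧
        slAct X.1.1 y - slActₗ 4 8 0 X.2 ∈ cayleySpan at this
      simpa using this
    exact mem_cayleySubalgebra.mpr
      ⟨eq_zero_of_slAct_mem (LinearMap.mem_ker.mp X.1.2) fun y hy => (h y hy).2,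
        mem_cayleySpan_of_kappaMat fun y hy => (h y hy).1⟩

/-! ## Conjugation into the Cartan subspace -/

theorem coeff_swap01 (ω : Form 4 8) (a b c d : Fin 8) :
    coeff ![b, a, c, d] ω = - coeff ![a, b, c, d] ω := by
  have := coeff_perm ![a, b, c, d] (Equiv.swap 0 1) ω
  rw [Equiv.Perm.sign_swap (by decide)] at this
  have h : ![a, b, c, d] ∘ Equiv.swap 0 1 = ![b, a, c, d] := by
    funext i
    fin_cases i <;> rfl
  rw [h] at this
  simpa using this

theorem coeff_swap12 (ω : Form 4 8) (a b c d : Fin 8) :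
    coeff ![a, c, b, d] ω = - coeff ![a, b, c, d] ω := by
  have := coeff_perm ![a, b, c, d] (Equiv.swap 1 2) ω
  rw [Equiv.Perm.sign_swap (by decide)] at this
  have h : ![a, b, c, d] ∘ Equiv.swap 1 2 = ![a, c, b, d] := by
    funext i
    fin_cases i <;> rfl
  rw [h] at this
  simpa using this

theorem coeff_swap23 (ω : Form 4 8) (a b c d : Fin 8) :
    coeff ![a, b, d, c] ω = - coeff ![a, b, c, d] ω := by
  have := coeff_perm ![a, b, c, d] (Equiv.swap 2 3) ω
  rw [Equiv.Perm.sign_swap (by decide)] at this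
  have h : ![a, b, c, d] ∘ Equiv.swap 2 3 = ![a, b, d, c] := by
    funext i
    fin_cases i <;> rfl
  rw [h] at this
  simpa using this

theorem coeff_slAct_rotation (ω : Form 4 8) (p q a b c d : Fin 8) :
    coeff ![a, b, c, d] (slAct (Matrix.single p q 1 - Matrix.single q p 1) ω) =
      ((if a = p then coeff ![q, b, c, d] ω else 0) + (if b = p then coeff ![a, q, c, d] ω else 0) +
       (if c = p then coeff ![a, b, q, d] ω else 0) + (if d = p then coeff ![a, b, c, q] ω else 0)) -
      ((if a = q then coeff ![p, b, c, d] ω else 0) + (if b = q then coeff ![a, p, c, d] ω else 0) +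
       (if c = q then coeff ![a, b, p, d] ω else 0) +
       (if d = q then coeff ![a, b, c, p] ω else 0)) := by
  have h : slAct (Matrix.single p q 1 - Matrix.single q p 1) ω =
      slAct (Matrix.single p q 1) ω - slAct (Matrix.single q p 1) ω := by
    rw [sub_eq_add_neg, slAct_add_left, slAct_neg_left, ← sub_eq_add_neg]
  have h0 : ∀ r, Function.update ![a, b, c, d] 0 r = ![r, b, c, d] := fun r => by
    funext i
    fin_cases i <;> rfl
  have h1 : ∀ r, Function.update ![a, b, c, d] 1 r = ![a, r, c, d] := fun r => by
    funext i
    fin_cases i <;> rfl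
  have h2 : ∀ r, Function.update ![a, b, c, d] 2 r = ![a, b, r, d] := fun r => by
    funext i
    fin_cases i <;> rfl
  have h3 : ∀ r, Function.update ![a, b, c, d] 3 r = ![a, b, c, r] := fun r => by
    funext i
    fin_cases i <;> rfl
  rw [h, map_sub, coeff_slAct_single, coeff_slAct_single, Fin.sum_univ_four, Fin.sum_univ_four]
  simp only [h0, h1, h2, h3]
  rfl

theorem hodge_pair {ω : Form 4 8} (hω : ω ∈ selfDual) (s t : Fin 4 → Fin 8) (n : ℤ)
    (h : Function.Injective (Fin.append s t) ∧ signTuple (Fin.append s t) = n) :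
    coeff t ω = n * coeff s ω := by
  rw [coeff_of_selfDual hω s t h.1, h.2]

/-- Oriented for `simp`: only descending neighbours are swapped, so rewriting sorts a multi-index
and stops. -/
theorem coeff_sort01 (ω : Form 4 8) (a b c d : Fin 8) (_ : b < a) :
    coeff ![a, b, c, d] ω = - coeff ![b, a, c, d] ω := coeff_swap01 ω b a c d

theorem coeff_sort12 (ω : Form 4 8) (a b c d : Fin 8) (_ : c < b) :
    coeff ![a, b, c, d] ω = - coeff ![a, c, b, d] ω := coeff_swap12 ω a c b d

theorem coeff_sort23 (ω : Form 4 8) (a b c d : Fin 8) (_ : d < c) :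
    coeff ![a, b, c, d] ω = - coeff ![a, b, d, c] ω := coeff_swap23 ω a b d c

theorem coeff_self01 (ω : Form 4 8) (a c d : Fin 8) : coeff ![a, a, c, d] ω = 0 := by
  have := coeff_swap01 ω a a c d
  linarith

theorem coeff_self12 (ω : Form 4 8) (a c d : Fin 8) : coeff ![a, c, c, d] ω = 0 := by
  have := coeff_swap12 ω a c c d
  linarith

theorem coeff_self23 (ω : Form 4 8) (a c d : Fin 8) : coeff ![a, c, d, d] ω = 0 := by
  have := coeff_swap23 ω a c d d
  linarith

/-- The multi-indices that contain the first axis and do not occur in the Cayley form. -/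
theorem mem_of_ne_codeword : ∀ b c d : Fin 8, 0 < b → b < c → c < d →
    (∀ e i, ![0, b, c, d] ≠ codeword e i) → (b, c, d) ∈ ([(1, 2, 4), (1, 2, 5), (1, 2, 6), (1, 2, 7),
      (1, 3, 4), (1, 3, 5), (1, 3, 6), (1, 3, 7), (1, 4, 6), (1, 4, 7), (1, 5, 6), (1, 5, 7),
      (2, 3, 4), (2, 3, 5), (2, 3, 6), (2, 3, 7), (2, 4, 5), (2, 4, 7), (2, 5, 6), (2, 6, 7),
      (3, 4, 5), (3, 4, 6), (3, 5, 7), (3, 6, 7), (4, 5, 6), (4, 5, 7), (4, 6, 7), (5, 6, 7)] :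
      List (Fin 8 × Fin 8 × Fin 8)) := by
  decide +kernel

/-- By self-duality this reduces multi-indices without the first axis to those containing it. -/
theorem exists_complement : ∀ a b c d : Fin 8, 0 < a → a < b → b < c → c < d →
    (∀ e i, ![a, b, c, d] ≠ codeword e i) → ∃ b' c' d' : Fin 8, (0 < b' ∧ b' < c' ∧ c' < d') ∧
      (∀ e i, ![0, b', c', d'] ≠ codeword e i) ∧
      ∀ x y, ![0, b', c', d'] x ≠ ![a, b, c, d] y := by
  decide +kernel

/-- The equation for `(p, q)` involves only coordinates obtained by exchanging `p` and `q` in one of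
three blocks. Numbering the axes in binary, the equations split according to `p XOR q` into systems
of four, whose coefficients are signed weights 1, 2, 4. No nonempty signed sum of 1, 2, 4 vanishes,
which makes these systems nonsingular. -/
theorem coeff_zero_of_critical {x : Form 4 8} (hx : x ∈ selfDual)
    (h : ∀ p q : Fin 8, p ≠ q →
      coeff ![0, 1, 2, 3] (slAct (Matrix.single p q 1 - Matrix.single q p 1) x) +
      2 * coeff ![0, 1, 4, 5] (slAct (Matrix.single p q 1 - Matrix.single q p 1) x) +
      4 * coeff ![0, 2, 4, 6] (slAct (Matrix.single p q 1 - Matrix.single q p 1) x) = 0)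
    (b c d : Fin 8) (hb : 0 < b) (hc : b < c) (hd : c < d)
    (hne : ∀ e i, ![0, b, c, d] ≠ codeword e i) : coeff ![0, b, c, d] x = 0 := by
  have hs := hodge_pair hx
  -- Replacing the axis 0 in the three blocks by one of the four outside axes gives twelve
  -- multi-indices without 0. Each is expressed through its complement.
  have s1 := hs ![0, 1, 3, 5] ![2, 4, 6, 7] (-1) (by decide +kernel)
  have s2 := hs ![0, 1, 3, 7] ![2, 4, 5, 6] (-1) (by decide +kernel)
  have s3 := hs ![0, 1, 5, 7] ![2, 3, 4, 6] (-1) (by decide +kernel)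
  have s4 := hs ![0, 2, 3, 6] ![1, 4, 5, 7] (-1) (by decide +kernel)
  have s5 := hs ![0, 2, 3, 7] ![1, 4, 5, 6] 1 (by decide +kernel)
  have s6 := hs ![0, 2, 6, 7] ![1, 3, 4, 5] (-1) (by decide +kernel)
  have s7 := hs ![0, 3, 5, 7] ![1, 2, 4, 6] (-1) (by decide +kernel)
  have s8 := hs ![0, 3, 6, 7] ![1, 2, 4, 5] 1 (by decide +kernel)
  have s9 := hs ![0, 4, 5, 6] ![1, 2, 3, 7] (-1) (by decide +kernel)
  have s10 := hs ![0, 4, 5, 7] ![1, 2, 3, 6] 1 (by decide +kernel)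
  have s11 := hs ![0, 4, 6, 7] ![1, 2, 3, 5] (-1) (by decide +kernel)
  have s12 := hs ![0, 5, 6, 7] ![1, 2, 3, 4] 1 (by decide +kernel)
  simp only [coeff_slAct_rotation] at h
  have e (p q : Fin 8) (hpq : p < q) := h p q hpq.ne
  have e01 := e 0 1 (by decide)
  have e02 := e 0 2 (by decide)
  have e03 := e 0 3 (by decide)
  have e04 := e 0 4 (by decide)
  have e05 := e 0 5 (by decide)
  have e06 := e 0 6 (by decide)
  have e07 := e 0 7 (by decide)
  have e12 := e 1 2 (by decide)
  have e13 := e 1 3 (by decide)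
  have e14 := e 1 4 (by decide)
  have e15 := e 1 5 (by decide)
  have e16 := e 1 6 (by decide)
  have e17 := e 1 7 (by decide)
  have e23 := e 2 3 (by decide)
  have e24 := e 2 4 (by decide)
  have e25 := e 2 5 (by decide)
  have e26 := e 2 6 (by decide)
  have e27 := e 2 7 (by decide)
  have e34 := e 3 4 (by decide)
  have e35 := e 3 5 (by decide)
  have e36 := e 3 6 (by decide)
  have e37 := e 3 7 (by decide)
  have e45 := e 4 5 (by decide)
  have e46 := e 4 6 (by decide)
  have e47 := e 4 7 (by decide)
  have e56 := e 5 6 (by decide)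
  have e57 := e 5 7 (by decide)
  have e67 := e 6 7 (by decide)
  clear h e hs
  have hl := mem_of_ne_codeword b c d hb hc hd hne
  clear hne hb hc hd hx
  simp [coeff_sort01, coeff_sort12, coeff_sort23, coeff_self01, coeff_self12, coeff_self23,
    s1, s2, s3, s4, s5, s6, s7, s8, s9, s10, s11, s12]
      at e01 e02 e03 e04 e05 e06 e07 e12 e13 e14 e15 e16 e17 e23 e24 e25 e26 e27 e34 e35
        e36 e37 e45 e46 e47 e56 e57 e67
  clear s1 s2 s3 s4 s5 s6 s7 s8 s9 s10 s11 s12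
  simp only [List.mem_cons, List.not_mem_nil, or_false, Prod.mk.injEq] at hl
  rcases hl with h | h | h | h | h | h | h | h | h | h | h | h | h | h | h | h | h | h | h | h | h |
    h | h | h | h | h | h | h <;> obtain ⟨rfl, rfl, rfl⟩ := h <;> linarith

theorem rotate_mem_selfDual {g : Matrix (Fin 8) (Fin 8) ℝ}
    (hg : g ∈ Matrix.specialOrthogonalGroup (Fin 8) ℝ) {ω : Form 4 8} (hω : ω ∈ selfDual) :
    rotate g ω ∈ selfDual := by
  obtain ⟨h1, h2⟩ := mem_specialOrthogonal.mp hg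
  rw [mem_selfDual, hodgeStar_rotate four_add_four h1 h2, (mem_selfDual ω).mp hω]

theorem eq_vec_four {α : Type*} (t : Fin 4 → α) : t = ![t 0, t 1, t 2, t 3] := by
  funext a
  fin_cases a <;> rfl

theorem exists_rotate_mem {ω : Form 4 8} (hω : ω ∈ selfDual) :
    ∃ g ∈ Matrix.specialOrthogonalGroup (Fin 8) ℝ, rotate g ω ∈ cayleySpan := by
  let u : Fin 3 → Fin 4 → Fin 8 := ![![0, 1, 2, 3], ![0, 1, 4, 5], ![0, 2, 4, 6]]
  -- On self-dual forms this functional is the pairing with half of `sdBasis 0 + 2 • sdBasis 1 + 4 •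
  -- sdBasis 3`, a regular element of the span.
  obtain ⟨g, hg, hcrit⟩ := exists_rotate_critical Finset.univ ![1, 2, 4]
    (fun i a => stdVec (u i a)) ω
  refine ⟨g, hg, ?_⟩
  have hx := rotate_mem_selfDual hg hω
  generalize rotate g ω = x at hx hcrit
  have hz := coeff_zero_of_critical hx fun p q hpq => by
    have := hcrit p q hpq
    rw [Fin.sum_univ_three] at this
    simpa [u, coeff_apply] using this
  refine mem_cayleySpan (fun t ht hne => ?_) fun i => ?_
  · have t01 : t 0 < t 1 := ht (by decide)
    have t12 : t 1 < t 2 := ht (by decide)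
    have t23 : t 2 < t 3 := ht (by decide)
    have ht4 := eq_vec_four t
    by_cases h0 : t 0 = 0
    · rw [h0] at ht4 t01
      rw [ht4]
      exact hz _ _ _ t01 t12 t23 (ht4 ▸ hne)
    · obtain ⟨b, c, d, ⟨hb, hc, hd⟩, hne', hdis⟩ := exists_complement (t 0) (t 1) (t 2) (t 3)
        (Fin.pos_of_ne_zero h0) t01 t12 t23 (ht4 ▸ hne)
      rw [← ht4] at hdis
      rw [coeff_of_selfDual hx ![0, b, c, d] t (Fin.append_injective_iff.mpr
        ⟨(strictMono_four _ ⟨hb, hc, hd⟩).injective, ht.injective, hdis⟩),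
        hz b c d hb hc hd hne', mul_zero]
  · rw [coeff_of_selfDual hx _ _ (append_codeword_injective false i), signTuple_codeword]
    simp

/-! ## The bound for the wedge square -/

theorem exists_disjoint : ∀ a b c d : Fin 8, a < b → b < c → c < d →
    ∃ a' b' c' d' : Fin 8, (a' < b' ∧ b' < c' ∧ c' < d') ∧
      ∀ x y, ![a', b', c', d'] x ≠ ![a, b, c, d] y := by
  decide +kernel

theorem signTuple_mul_self {k m : ℕ} {w : Fin k → Fin m} (hw : Function.Injective w) :
    signTuple w * signTuple w = 1 := by
  simp only [signTuple, ← Finset.prod_mul_distrib]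
  refine Finset.prod_eq_one fun i _ => Finset.prod_eq_one fun j hj => ?_
  rcases lt_trichotomy (w i) (w j) with h | h | h
  · simp [h]
  · exact absurd (hw h) (Finset.mem_Ioi.mp hj).ne
  · simp [h, h.not_gt]

theorem hodgeStarₗ_apply {k l m : ℕ} (h : k + l = m) (ω : Form k m) :
    hodgeStarₗ h ω = hodgeStar h ω := rfl

/-- Applying the star twice multiplies the signs of the two orders of a complementary pair. They are
equal because 4-forms commute under the wedge. -/
theorem hodgeStar_hodgeStar (ω : Form 4 8) :
    hodgeStar four_add_four (hodgeStar four_add_four ω) = ω := by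
  have : hodgeStarₗ four_add_four ∘ₗ hodgeStarₗ four_add_four =
      (LinearMap.id : Form 4 8 →ₗ[ℝ] Form 4 8) := by
    refine linearMap_ext_dx fun s hs => ?_
    obtain ⟨a, b, c, d, ht, hd⟩ := exists_disjoint (s 0) (s 1) (s 2) (s 3) (hs (by decide))
      (hs (by decide)) (hs (by decide))
    rw [← eq_vec_four s] at hd
    have ht' := (strictMono_four ![a, b, c, d] ht).injective
    have h1 : Function.Injective (Fin.append ![a, b, c, d] s) :=
      Fin.append_injective_iff.mpr ⟨ht', hs.injective, hd⟩
    have h2 : Function.Injective (Fin.append s ![a, b, c, d]) :=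
      Fin.append_injective_iff.mpr ⟨hs.injective, ht', fun x y => (hd y x).symm⟩
    have hsym : ((signTuple (Fin.append ![a, b, c, d] s) : ℤ) : ℝ) =
        signTuple (Fin.append s ![a, b, c, d]) := by
      rw [← topCoeff_dx four_add_four, ← topCoeff_dx four_add_four, ← wedgeTop_dx, ← wedgeTop_dx,
        wedgeTop_comm]
    have e1 : hodgeStarₗ four_add_four (dx s) = _ := hodgeStar_dx s _ h1
    have e2 : hodgeStarₗ four_add_four (dx ![a, b, c, d]) = _ := hodgeStar_dx _ s h2
    rw [LinearMap.comp_apply, e1, map_smul, e2, smul_smul, hsym, ← Int.cast_mul,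
      signTuple_mul_self h2, Int.cast_one, one_smul, LinearMap.id_apply]
  rw [← hodgeStarₗ_apply, ← hodgeStarₗ_apply, ← LinearMap.comp_apply, this, LinearMap.id_apply]

theorem wedgeTop_self_le (ω : Form 4 8) : wedgeTop four_add_four ω ω ≤ 14 * comass ω ^ 2 := by
  set η := hodgeStar four_add_four ω with hη
  have hσ : ω + η ∈ selfDual := by
    change hodgeStarₗ four_add_four (ω + η) = ω + η
    rw [map_add]
    change η + hodgeStar four_add_four η = ω + η
    rw [hη, hodgeStar_hodgeStar, add_comm]
  obtain ⟨g, hg, hmem⟩ := exists_rotate_mem hσ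
  obtain ⟨h1, h2⟩ := mem_specialOrthogonal.mp hg
  -- The difference of the two sides is `|ω - η|²`.
  have hle : 4 * formInner 4 8 η ω ≤ formInner 4 8 (ω + η) (ω + η) := by
    have := formInner_self_nonneg (ω - η)
    have hc := formInner_comm η ω
    simp only [map_sub, map_add, LinearMap.sub_apply, LinearMap.add_apply] at this ⊢
    linarith
  rw [← formInner_rotate_self h1 (ω + η) (ω + η), formInner_self_of_mem hmem,
    hη, formInner_hodgeStar four_add_four ω ω, ← hη] at hle
  have hbound : ∀ i, coeff (codeword true i) (rotate g (ω + η)) ^ 2 ≤ 4 * comass ω ^ 2 := by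
    intro i
    -- The rotation commutes with the star, so the coefficient of the rotated `*ω` at a block is
    -- that of the rotated `ω` at the complement.
    have e : coeff (codeword true i) (rotate g (ω + η)) =
        coeff (codeword true i) (rotate g ω) + coeff (codeword false i) (rotate g ω) := by
      change coeff (codeword true i) (rotate g ω + rotate g η) = _
      rw [map_add, hη, ← hodgeStar_rotate four_add_four h1 h2,
        coeff_hodgeStar_eq _ _ _ _ (append_codeword_injective true i), signTuple_codeword]
      simp
    have b1 := abs_coeff_le_comass (rotate g ω) (codeword true i)
    have b2 := abs_coeff_le_comass (rotate g ω) (codeword false i)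
    rw [comass_rotate h1] at b1 b2
    have b3 : |coeff (codeword true i) (rotate g (ω + η))| ≤ 2 * comass ω := by
      rw [e]
      exact (abs_add_le _ _).trans (by linarith)
    calc _ = |coeff (codeword true i) (rotate g (ω + η))| ^ 2 := (sq_abs _).symm
      _ ≤ (2 * comass ω) ^ 2 := pow_le_pow_left₀ (abs_nonneg _) b3 2
      _ = _ := by ring
  have hsum := Finset.sum_le_sum fun i (_ : i ∈ Finset.univ) => hbound i
  rw [Finset.sum_const, Finset.card_univ, Fintype.card_fin, nsmul_eq_mul] at hsum
  push_cast at hsum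
  linarith

theorem abs_wedgeTop_self_le (ω : Form 4 8) :
    |wedgeTop four_add_four ω ω| ≤ 14 * comass ω ^ 2 := by
  refine abs_le'.mpr ⟨wedgeTop_self_le ω, ?_⟩
  -- A reflection keeps the comass and reverses the sign of `ω∧ω`.
  let r : Matrix (Fin 8) (Fin 8) ℝ := Matrix.diagonal (Function.update 1 0 (-1))
  have hr : r.transpose * r = 1 := by
    rw [Matrix.diagonal_transpose, Matrix.diagonal_mul_diagonal, ← Matrix.diagonal_one]
    congr 1
    funext i
    by_cases hi : i = 0
    · subst hi; simp
    · simp [hi]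
  have hdet : r.det = -1 := by
    rw [Matrix.det_diagonal, Finset.prod_update_of_mem (Finset.mem_univ _)]
    simp
  have := wedgeTop_self_le (rotate r ω)
  rwa [wedgeTop_rotate, hdet, comass_rotate hr, neg_one_mul] at this

theorem euclNorm_sq_le {ω : Form 4 8} (hω : ω ∈ selfDual) :
    euclNorm ω ^ 2 ≤ 14 * comass ω ^ 2 := by
  rw [euclNorm_sq, ← wedgeTop_of_selfDual hω]
  exact wedgeTop_self_le ω

theorem euclNorm_top {k m : ℕ} (h : k = m) (η : Form k m) : euclNorm η = |topCoeff h η| := by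
  subst h
  have : incTuples k k = {id} := by
    ext t
    rw [mem_incTuples, Finset.mem_singleton]
    exact ⟨fun ht => strictMono_unique ht strictMono_id fun a => ⟨t a, rfl⟩,
      fun ht => ht ▸ strictMono_id⟩
  rw [euclNorm, this, Finset.sum_singleton, Real.sqrt_sq_eq_abs]
  rfl

/-! ## The comass of the Cayley form -/

/-- The bilinear form obtained from the Cayley form by fixing its two middle arguments. -/
def cayleyMat (v w : E 8) : Matrix (Fin 8) (Fin 8) ℝ :=
  let m : Fin 8 → Fin 8 → ℝ := fun a b => v a * w b - v b * w a
  !![0, m 2 3 + m 4 5 + m 6 7, m 3 1 + m 4 6 + m 7 5, m 1 2 + m 6 5 + m 7 4,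
      m 3 7 + m 5 1 + m 6 2, m 1 4 + m 2 7 + m 3 6, m 2 4 + m 5 3 + m 7 1, m 1 6 + m 4 3 + m 5 2;
    m 3 2 + m 5 4 + m 7 6, 0, m 0 3 + m 6 5 + m 7 4, m 2 0 + m 5 7 + m 6 4,
      m 0 5 + m 2 7 + m 3 6, m 2 6 + m 4 0 + m 7 3, m 0 7 + m 4 3 + m 5 2, m 3 5 + m 4 2 + m 6 0;
    m 1 3 + m 5 7 + m 6 4, m 3 0 + m 4 7 + m 5 6, 0, m 0 1 + m 4 5 + m 6 7,
      m 0 6 + m 5 3 + m 7 1, m 3 4 + m 6 1 + m 7 0, m 1 5 + m 4 0 + m 7 3, m 0 5 + m 1 4 + m 3 6;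
    m 2 1 + m 4 7 + m 5 6, m 0 2 + m 4 6 + m 7 5, m 1 0 + m 5 4 + m 7 6, 0,
      m 2 5 + m 6 1 + m 7 0, m 1 7 + m 4 2 + m 6 0, m 0 5 + m 1 4 + m 2 7, m 0 4 + m 5 1 + m 6 2;
    m 1 5 + m 2 6 + m 7 3, m 5 0 + m 6 3 + m 7 2, m 1 7 + m 3 5 + m 6 0, m 0 7 + m 1 6 + m 5 2,
      0, m 0 1 + m 2 3 + m 6 7, m 0 2 + m 3 1 + m 7 5, m 2 1 + m 3 0 + m 5 6;
    m 4 1 + m 6 3 + m 7 2, m 0 4 + m 3 7 + m 6 2, m 0 7 + m 1 6 + m 4 3, m 0 6 + m 2 4 + m 7 1,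
      m 1 0 + m 3 2 + m 7 6, 0, m 2 1 + m 3 0 + m 4 7, m 1 3 + m 2 0 + m 6 4;
    m 1 7 + m 3 5 + m 4 2, m 2 5 + m 3 4 + m 7 0, m 0 4 + m 3 7 + m 5 1, m 4 1 + m 5 0 + m 7 2,
      m 1 3 + m 2 0 + m 5 7, m 0 3 + m 1 2 + m 7 4, 0, m 0 1 + m 2 3 + m 4 5;
    m 2 5 + m 3 4 + m 6 1, m 0 6 + m 2 4 + m 5 3, m 4 1 + m 5 0 + m 6 3, m 1 5 + m 2 6 + m 4 0,
      m 0 3 + m 1 2 + m 6 5, m 0 2 + m 3 1 + m 4 6, m 1 0 + m 3 2 + m 5 4, 0]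

-- The map `z ↦ Mz` is a triple cross product on `ℝ⁸`. Polarized in `z`, this identity says that
-- `|Mz|²` is the Gram determinant of `v, w, z`.
set_option maxHeartbeats 2000000 in
theorem cayleyMat_gram (v w : E 8) (i j : Fin 8) :
    ∑ k, cayleyMat v w k i * cayleyMat v w k j =
      ((∑ a, v a * v a) * (∑ a, w a * w a) - (∑ a, v a * w a) ^ 2) * (if i = j then 1 else 0) -
      ((∑ a, w a * w a) * (v i * v j) - (∑ a, v a * w a) * (v i * w j + w i * v j) +
        (∑ a, v a * v a) * (w i * w j)) := by
  simp only [Fin.sum_univ_eight]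
  fin_cases i <;> fin_cases j <;>
    simp only [cayleyMat, Matrix.of_apply, Matrix.cons_val, Fin.reduceFinMk, Fin.isValue,
      Fin.mk_zero, Fin.mk_one, Fin.reduceEq, if_true, if_false] <;>
    ring

/-- Expansion through the `2 × 2` minors of the two middle rows, the same minors from which
`cayleyMat` is built. -/
theorem det_four (M : Matrix (Fin 4) (Fin 4) ℝ) : M.det =
    let m : Fin 4 → Fin 4 → ℝ := fun a b => M 1 a * M 2 b - M 1 b * M 2 a
    M 0 0 * (M 3 1 * m 2 3 + M 3 2 * m 3 1 + M 3 3 * m 1 2) +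
      M 0 1 * (M 3 0 * m 3 2 + M 3 2 * m 0 3 + M 3 3 * m 2 0) +
      M 0 2 * (M 3 0 * m 1 3 + M 3 1 * m 3 0 + M 3 3 * m 0 1) +
      M 0 3 * (M 3 0 * m 2 1 + M 3 1 * m 0 2 + M 3 2 * m 1 0) := by
  have h1 : (1 : Fin 4).succAbove 2 = 3 := rfl
  have h2 : (2 : Fin 4).succAbove 2 = 3 := rfl
  have h3 : (3 : Fin 4).succAbove 2 = 2 := rfl
  simp [Matrix.det_succ_row_zero, Fin.sum_univ_succ, h1, h2, h3]
  ring

theorem cayley_apply (v : Fin 4 → E 8) :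
    cayley v = ∑ i, v 0 i * ∑ j, cayleyMat (v 1) (v 2) i j * v 3 j := by
  have h : ∀ b i, dx (codeword b i) v = _ := fun b i => det_four _
  simp only [cayley_eq, sdBasis, AlternatingMap.add_apply, AlternatingMap.sub_apply, h]
  simp [codeword, cw, cwCompl, cayleyMat, Fin.sum_univ_eight]
  ring

/-- The value is the inner product of `v 0` with `y = M (v 3)`, and `|y|²` is the Gram determinant
of three unit vectors, hence at most 1. Cauchy–Schwarz concludes. -/
theorem cayley_apply_le (v : Fin 4 → E 8) (hv : ∀ i, ‖v i‖ = 1) : cayley v ≤ 1 := by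
  have hn : ∀ i, ∑ a, v i a * v i a = 1 := fun i => by
    have := EuclideanSpace.real_norm_sq_eq (v i)
    rw [hv, one_pow] at this
    rw [this]
    exact Finset.sum_congr rfl fun a _ => (sq _).symm
  set y : Fin 8 → ℝ := fun k => ∑ j, cayleyMat (v 1) (v 2) k j * v 3 j with hy
  have hy2 : ∑ k, y k * y k ≤ 1 := by
    have h1 : ∑ k, y k * y k = ∑ i, ∑ j, v 3 i * v 3 j *
        ∑ k, cayleyMat (v 1) (v 2) k i * cayleyMat (v 1) (v 2) k j := by
      simp only [hy, Finset.sum_mul_sum]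
      simp only [Finset.mul_sum]
      rw [Finset.sum_comm]
      refine Finset.sum_congr rfl fun i _ => ?_
      rw [Finset.sum_comm]
      exact Finset.sum_congr rfl fun j _ => Finset.sum_congr rfl fun k _ => by ring
    set g := ∑ a, v 1 a * v 2 a with hg
    have hcs : g ^ 2 ≤ 1 := by
      have := Finset.sum_mul_sq_le_sq_mul_sq Finset.univ (v 1) (v 2)
      simp only [sq (v 1 _), sq (v 2 _), hn] at this
      linarith
    set s := ∑ a, v 1 a * v 3 a with hs
    set t := ∑ a, v 2 a * v 3 a with ht
    have h2 : ∑ k, y k * y k = (1 - g ^ 2) - (s ^ 2 - 2 * g * s * t + t ^ 2) := by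
      rw [h1]
      simp only [cayleyMat_gram, hn, ← hg]
      have e1 : ∀ i j, v 3 i * v 3 j * ((1 * 1 - g ^ 2) * (if i = j then (1 : ℝ) else 0) -
          (1 * (v 1 i * v 1 j) - g * (v 1 i * v 2 j + v 2 i * v 1 j) + 1 * (v 2 i * v 2 j))) =
          (if i = j then (1 - g ^ 2) * (v 3 i * v 3 j) else 0) - (v 1 i * v 3 i) * (v 1 j * v 3 j) +
          g * ((v 1 i * v 3 i) * (v 2 j * v 3 j)) + g * ((v 2 i * v 3 i) * (v 1 j * v 3 j)) -
          (v 2 i * v 3 i) * (v 2 j * v 3 j) := by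
        intro i j
        split_ifs <;> ring
      simp only [e1, Finset.sum_add_distrib, Finset.sum_sub_distrib, ← Finset.mul_sum,
        ← Finset.sum_mul, ← hs, ← ht, Finset.sum_ite_eq, Finset.mem_univ, if_true, hn]
      ring
    rw [h2]
    -- Completing the square: `s² - 2gst + t² = (s - gt)² + (1 - g²)t²`.
    nlinarith [sq_nonneg (s - g * t), mul_nonneg (sub_nonneg.mpr hcs) (sq_nonneg t), sq_nonneg g]
  have h3 := Finset.sum_mul_sq_le_sq_mul_sq Finset.univ (v 0) y
  simp only [sq (v 0 _), sq (y _), hn, one_mul] at h3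
  rw [cayley_apply]
  exact (abs_le_one_iff_mul_self_le_one.mpr (by rw [← sq]; exact h3.trans hy2) |> abs_le.mp).2

theorem comass_cayley : comass cayley = 1 := by
  refine le_antisymm (csSup_le ?_ ?_) ?_
  · exact ⟨_, fun i => stdVec (cw 0 i), fun i => by simp, rfl⟩
  · rintro r ⟨v, hv, rfl⟩
    exact cayley_apply_le v hv
  · have h : coeff (codeword true 0) cayley = 1 := by
      rw [cayley_eq]
      simp only [map_add, map_sub, coeff_codeword_sdBasis]
      simp
    rw [← h]
    exact apply_le_comass cayley fun i => by simp

/-! ## Two-forms on four-space -/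

theorem update_pair {α : Type*} (a b c : α) : Function.update ![a, b] 1 c = ![a, c] := by
  funext i
  fin_cases i <;> rfl

theorem abs_apply_pair_le (ω : Form 2 4) (i : Fin 4) (x : E 4) :
    |ω ![stdVec i, x]| ≤ comass ω * ‖x‖ := by
  by_cases hx : x = 0
  · have : ω ![stdVec i, x] = 0 := ω.map_coord_zero 1 (by simpa using hx)
    rw [this, hx]
    simp
  · have hx' : ‖x‖ ≠ 0 := norm_ne_zero_iff.mpr hx
    have h1 := abs_apply_le_comass ω (v := ![stdVec i, ‖x‖⁻¹ • x]) fun a => by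
      fin_cases a
      · simp
      · simp [norm_smul, hx']
    have h2 : ω ![stdVec i, ‖x‖⁻¹ • x] = ‖x‖⁻¹ * ω ![stdVec i, x] := by
      have := ω.map_update_smul ![stdVec i, x] 1 ‖x‖⁻¹ x
      rwa [update_pair, update_pair, smul_eq_mul] at this
    rw [h2, abs_mul, abs_inv, abs_norm, inv_mul_le_iff₀ (norm_pos_iff.mpr hx), mul_comm] at h1
    exact h1

theorem apply_pair (ω : Form 2 4) (i : Fin 4) (x : E 4) :
    ω ![stdVec i, x] = ∑ j, x j * coeff ![i, j] ω := by
  have hx : x = ∑ j, x j • stdVec j := by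
    ext a
    simp [Pi.single_apply]
  rw [← update_pair (stdVec i) x x]
  conv_lhs => rw [hx, AlternatingMap.map_update_sum]
  refine Finset.sum_congr rfl fun j _ => ?_
  rw [AlternatingMap.map_update_smul, smul_eq_mul, coeff_apply]
  congr 2
  funext a
  fin_cases a <;> rfl

/-- The skew matrix of coefficients of a `2`-form. -/
def pairMat (ω : Form 2 4) : Matrix (Fin 4) (Fin 4) ℝ := Matrix.of fun i j => coeff ![i, j] ω

/-- The row `r` represents the functional `ω(e_i, ·)`. Evaluating it at `r` itself gives `|r|² ≤ ‖ω‖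
|r|`. -/
theorem norm_row_le (ω : Form 2 4) (i : Fin 4) :
    ‖(WithLp.toLp 2 (pairMat ω i) : E 4)‖ ≤ comass ω := by
  set r : E 4 := WithLp.toLp 2 (pairMat ω i) with hr
  have h1 := abs_apply_pair_le ω i r
  have h2 : ω ![stdVec i, r] = ‖r‖ ^ 2 := by
    rw [apply_pair, EuclideanSpace.real_norm_sq_eq]
    exact Finset.sum_congr rfl fun j _ => (sq _).symm
  rw [h2, abs_of_nonneg (sq_nonneg _), sq] at h1
  by_cases h0 : ‖r‖ = 0
  · rw [h0]
    exact comass_nonneg ω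
  · exact le_of_mul_le_mul_right h1 (lt_of_le_of_ne (norm_nonneg _) (Ne.symm h0))

/-- Hadamard's inequality. -/
theorem abs_det_le {m : ℕ} (M : Matrix (Fin m) (Fin m) ℝ) :
    |M.det| ≤ ∏ i, ‖(WithLp.toLp 2 (M i) : E m)‖ := by
  have : Fact (Module.finrank ℝ (E m) = m) := ⟨by simp⟩
  have h := (EuclideanSpace.basisFun (Fin m) ℝ).toBasis.orientation.abs_volumeForm_apply_le
    fun i => WithLp.toLp 2 (M i)
  rw [Orientation.volumeForm_robust _ (EuclideanSpace.basisFun (Fin m) ℝ) rfl,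
    Module.Basis.det_apply, ← Matrix.det_transpose] at h
  convert h using 2
  congr 1

theorem coeff_pair_swap (ω : Form 2 4) (i j : Fin 4) : coeff ![j, i] ω = - coeff ![i, j] ω := by
  have := coeff_perm ![i, j] (Equiv.swap 0 1) ω
  rw [Equiv.Perm.sign_swap (by decide)] at this
  have h : ![i, j] ∘ Equiv.swap 0 1 = ![j, i] := by
    funext a
    fin_cases a <;> rfl
  rw [h] at this
  simpa using this

/-- The Pfaffian of a `2`-form. -/
def pfaffian (ω : Form 2 4) : ℝ :=
  coeff ![0, 1] ω * coeff ![2, 3] ω - coeff ![0, 2] ω * coeff ![1, 3] ω +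
    coeff ![0, 3] ω * coeff ![1, 2] ω

theorem det_pairMat (ω : Form 2 4) : (pairMat ω).det = pfaffian ω ^ 2 := by
  have hd : ∀ i, coeff ![i, i] ω = 0 := fun i => by
    have := coeff_pair_swap ω i i
    linarith
  rw [det_four]
  simp only [pairMat, Matrix.of_apply, hd, coeff_pair_swap ω 0 1, coeff_pair_swap ω 0 2,
    coeff_pair_swap ω 0 3, coeff_pair_swap ω 1 2, coeff_pair_swap ω 1 3, coeff_pair_swap ω 2 3,
    pfaffian]
  ring

theorem two_add_two : 2 + 2 = 4 := rfl

theorem incTuples_two_four : incTuples 2 4 =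
    {![0, 1], ![0, 2], ![0, 3], ![1, 2], ![1, 3], ![2, 3]} := by
  ext t
  have h2 : StrictMono t ↔ t 0 < t 1 := by
    rw [Fin.strictMono_iff_lt_succ]
    exact ⟨fun h => h 0, fun h i => by fin_cases i; exact h⟩
  rw [mem_incTuples, h2]
  revert t
  decide +kernel

theorem wedgeTop_self_two (ω : Form 2 4) : wedgeTop two_add_two ω ω = 2 * pfaffian ω := by
  have h : ∀ s t : Fin 2 → Fin 4, ∀ n : ℤ, Function.Injective (Fin.append s t) ∧
      signTuple (Fin.append s t) = n → coeff t (hodgeStar two_add_two ω) = n * coeff s ω :=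
    fun s t n hst => by rw [coeff_hodgeStar_eq _ _ _ _ hst.1, hst.2]
  have h1 := h ![2, 3] ![0, 1] 1 (by decide +kernel)
  have h2 := h ![1, 3] ![0, 2] (-1) (by decide +kernel)
  have h3 := h ![1, 2] ![0, 3] 1 (by decide +kernel)
  have h4 := h ![0, 3] ![1, 2] 1 (by decide +kernel)
  have h5 := h ![0, 2] ![1, 3] (-1) (by decide +kernel)
  have h6 := h ![0, 1] ![2, 3] 1 (by decide +kernel)
  rw [← formInner_hodgeStar, formInner_apply, incTuples_two_four,
    Finset.sum_insert (by decide), Finset.sum_insert (by decide), Finset.sum_insert (by decide),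
    Finset.sum_insert (by decide), Finset.sum_insert (by decide), Finset.sum_singleton,
    h1, h2, h3, h4, h5, h6, pfaffian]
  push_cast
  ring

/-- Hadamard's inequality bounds `Pf² = det` by the fourth power of the comass, and `ω∧ω` is twice
the Pfaffian. -/
theorem abs_wedgeTop_self_two_le (ω : Form 2 4) :
    |wedgeTop two_add_two ω ω| ≤ 2 * comass ω ^ 2 := by
  have h := (abs_det_le (pairMat ω)).trans
    (Finset.prod_le_prod (fun i _ => norm_nonneg _) fun i _ => norm_row_le ω i)
  rw [det_pairMat, Finset.prod_const, Finset.card_univ, Fintype.card_fin, abs_pow,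
    show comass ω ^ 4 = (comass ω ^ 2) ^ 2 by ring] at h
  have h2 := (pow_le_pow_iff_left₀ (abs_nonneg _) (sq_nonneg _) two_ne_zero).mp h
  rw [wedgeTop_self_two, abs_mul, abs_two]
  linarith

/-- The standard symplectic form on four-space. -/
def kaehler : Form 2 4 := dx ![0, 1] + dx ![2, 3]

theorem pfaffian_kaehler : pfaffian kaehler = 1 := by
  simp [pfaffian, kaehler, coeff_dx, Matrix.det_fin_two]

theorem comass_kaehler : comass kaehler = 1 := by
  refine le_antisymm (csSup_le ?_ ?_) ?_
  · exact ⟨_, fun i => stdVec (![0, 1] i), fun i => by simp, rfl⟩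
  · rintro r ⟨v, hv, rfl⟩
    have h : kaehler v = (v 0 0 * v 1 1 - v 0 1 * v 1 0) + (v 0 2 * v 1 3 - v 0 3 * v 1 2) := by
      rw [kaehler, AlternatingMap.add_apply, dx_apply, dx_apply, Matrix.det_fin_two,
        Matrix.det_fin_two]
      rfl
    have h0 := EuclideanSpace.real_norm_sq_eq (v 0)
    have h1 := EuclideanSpace.real_norm_sq_eq (v 1)
    rw [hv, one_pow, Fin.sum_univ_four] at h0 h1
    rw [h]
    -- The four squares add up to `|v 0|² + |v 1|² - 2 ω(v 0, v 1)` for this form `ω`.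
    nlinarith [sq_nonneg (v 0 0 - v 1 1), sq_nonneg (v 0 1 + v 1 0), sq_nonneg (v 0 2 - v 1 3),
      sq_nonneg (v 0 3 + v 1 2)]
  · have h : coeff ![0, 1] kaehler = 1 := by
      simp [kaehler, coeff_dx, Matrix.det_fin_two]
    rw [← h]
    exact apply_le_comass kaehler fun i => by simp

/-! ## The Wirtinger constants -/

theorem isGreatest_wirtingerRatios_two : IsGreatest (wirtingerRatios 2) 2 := by
  have hw : ∀ ω : Form 2 4, euclNorm (wedge ω ω) = |wedgeTop two_add_two ω ω| :=
    fun ω => euclNorm_top two_add_two (wedge ω ω)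
  constructor
  · have h0 : kaehler ≠ 0 := fun h => by
      have := pfaffian_kaehler
      rw [h] at this
      simp [pfaffian] at this
    refine ⟨kaehler, h0, ?_⟩
    refine (congrArg₂ (· / ·) (hw kaehler) rfl).trans ?_
    change |_| / comass kaehler ^ 2 = 2
    rw [wedgeTop_self_two, pfaffian_kaehler, comass_kaehler]
    norm_num
  · rintro r ⟨ω, hω, rfl⟩
    -- The ratios are stated on `ℝ^(2 * 2)`. Restating the bound with the literal dimension 4 lets
    -- the rewriting match.
    have h : ∀ ω : Form 2 4, ω ≠ 0 → euclNorm (wedge ω ω) / comass ω ^ 2 ≤ 2 := fun ω hω => by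
      rw [div_le_iff₀ (pow_pos (comass_pos hω) 2), hw]
      exact abs_wedgeTop_self_two_le ω
    exact h ω hω

theorem isGreatest_wirtingerRatios_four : IsGreatest (wirtingerRatios 4) 14 := by
  have hw : ∀ ω : Form 4 8, euclNorm (wedge ω ω) = |wedgeTop four_add_four ω ω| :=
    fun ω => (euclNorm_top four_add_four (wedge ω ω)).trans (by rw [wedgeTop_apply])
  constructor
  · have h0 : cayley ≠ 0 := fun h => by
      have h1 := euclNorm_cayley
      rw [h, euclNorm_sq, map_zero] at h1
      norm_num at h1
    refine ⟨cayley, h0, ?_⟩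
    refine (congrArg₂ (· / ·) (hw cayley) rfl).trans ?_
    change |_| / comass cayley ^ 2 = 14
    rw [wedgeTop_of_selfDual (cayleySpan_le_selfDual cayley_mem), ← euclNorm_sq, euclNorm_cayley,
      comass_cayley]
    norm_num
  · rintro r ⟨ω, hω, rfl⟩
    have h : ∀ ω : Form 4 8, ω ≠ 0 → euclNorm (wedge ω ω) / comass ω ^ 2 ≤ 14 := fun ω hω => by
      rw [div_le_iff₀ (pow_pos (comass_pos hω) 2), hw]
      exact abs_wedgeTop_self_le ω
    exact h ω hω

theorem wirtingerConst_two : wirtingerConst 2 = 2 := isGreatest_wirtingerRatios_two.csSup_eq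

theorem wirtingerConst_four : wirtingerConst 4 = 14 := isGreatest_wirtingerRatios_four.csSup_eq

end WirtingerE7

end

theorem mainTheorem5 :
    -- the Wirtinger constants: the ratios have a maximum, with the stated value
    (IsGreatest (wirtingerRatios 2) (wirtingerConst 2) ∧ wirtingerConst 2 = 2) ∧
    (IsGreatest (wirtingerRatios 4) (wirtingerConst 4) ∧ wirtingerConst 4 = 14) ∧
    -- the Cayley form: self-dual, of unit comass, with squared Euclidean norm 14
    (cayley ∈ selfDual ∧ cayley ∈ cayleySpan ∧ comass cayley = 1 ∧ euclNorm cayley ^ 2 = 14) ∧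
    -- the span of the seven forms is a 7-dimensional maximal abelian subspace of the self-dual forms
    (Module.finrank ℝ cayleySpan = 7 ∧
      Maximal (fun a : Submodule ℝ (Form 4 8) => a ≤ selfDual ∧ IsAbelianInE7 a) cayleySpan) ∧
    -- and a Cartan subalgebra of the Lie algebra `E₇`
    (∃ H : LieSubalgebra ℝ E7,
      H.toSubmodule = cayleySpan.map E7.ofForm ∧ H.IsCartanSubalgebra) ∧
    -- every self-dual form is conjugate into it by a rotation
    (∀ ω ∈ selfDual, ∃ g ∈ Matrix.specialOrthogonalGroup (Fin 8) ℝ, rotate g ω ∈ cayleySpan) ∧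
    -- the resulting bound for self-dual forms
    (∀ ω ∈ selfDual, euclNorm ω ^ 2 ≤ 14 * comass ω ^ 2) := by
  exact
    ⟨⟨by rw [wirtingerConst_two]; exact isGreatest_wirtingerRatios_two, wirtingerConst_two⟩,
    ⟨by rw [wirtingerConst_four]; exact isGreatest_wirtingerRatios_four, wirtingerConst_four⟩,
    ⟨cayleySpan_le_selfDual cayley_mem, cayley_mem, comass_cayley, euclNorm_cayley⟩,
    ⟨finrank_cayleySpan, maximal_cayleySpan⟩,
    ⟨cayleySubalgebra, rfl, isCartan_cayleySubalgebra⟩,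
    fun _ hω => exists_rotate_mem hω, fun _ hω => euclNorm_sq_le hω⟩
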